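/- Let $f:\mathbb R^d\to\mathbb R$ be differentiable and bounded below, with $\|\nabla f(x)-\nabla f(y)\|\le L\|x-y\|$ for all $x,y$, where $L>0$. Put $f^\star=\inf f$ and $\bar f=f-f^\star+1$. Let $z_1,z_2,\dots$ be independent random variables with values in a measurable space $\mathcal Z$, let $\mathscr F_t=\sigma(z_1,\dots,z_t)$, and let $g:\mathbb R^d\times\mathcal Z\to\mathbb R^d$ be measurable. Let $\beta_1\in[0,1)$, $v>0$, $\epsilon>0$, $\eta>0$, $T\ge 10$ an integer, $\beta_2=1-1/T$ and $\gamma=\eta/\sqrt T$. Adam started at $x_1\in\mathbb R^d$ with $m_0=0$, $v_0=v\mathbf 1$ is, with all operations coordinatewise and for $t=1,\dots,T$, $$g_t=g(x_t;z_t),\quad m_t=\beta_1m_{t-1}+(1-\beta_1)g_t,\quad v_t=\beta_2v_{t-1}+(1-\beta_2)\,g_t\odot g_t,\quad \gamma_t=\gamma(\sqrt{v_t}+\epsilon)^{-1},\quad x_{t+1}=x_t-\gamma_t\odot m_t .$$ Assume that for every $1\le t\le T$ one has $\mathbb E[g_t\mid\mathscr F_{t-1}]=\nabla f(x_t)$ and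 $\mathbb E[\|g_t-\nabla f(x_t)\|^2\mid\mathscr F_{t-1}]\le C$ almost surely, where $C\ge 0$. Define $$D_{\beta_1}=\Big(4(1-\beta_1)\sup_{S\ge 10}\sum_{r=0}^{S-1}\Big(\frac{S\beta_1}{S-1}\Big)^r\Big)^{1/2},\qquad l=\exp\Big\{\frac{L\beta_1^2dD_{\beta_1}^2}{(1-\beta_1)^2}\Big\},\qquad B_0=2\Big(1+\frac{2L}{\sqrt v+\epsilon}\Big)\bar f(x_1),$$ the supremum being over integers $S\ge10$, and assume that $$\frac1\eta\ge\max\Big\{\frac{8d\epsilon}{v^{3/2}}+\frac{8d}{\sqrt v},\ \frac{D_{\beta_1}\beta_1\sqrt{dL}}{1-\beta_1},\ 1\Big\}.$$ Then there is a constant $U\ge1$, depending only on $d,L,C,v,\epsilon,\beta_1$ and $\bar f(x_1)$ (in particular not on $T$, $\eta$ or $\delta$), such that for every $0<\delta<1$, with probability at least $1-\delta$, $$\sum_{t=1}^T\sum_{i=1}^d\gamma_{t,i}\,(\nabla f(x_t))_i^2\le 16\max\Big\{\Big[\log\frac{24l\,(1+e^{2\cdot6^{1/6}B_0^{1/6}})}{\delta}\Big]^6,\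 \Big[2\log\frac{24l}{\delta}\Big]^6,\ 300^6,\ \Big[2\log\frac{24lU^2}{\delta}\Big]^6\Big\}.$$ -/

import Mathlib

noncomputable section

namespace AdamEnergy

/-- Hyperparameters of Adam: step size `γ`, scalar initialization `v` of the second moment
(`v₀ = v 𝟏`), regularizer `ε`, momentum parameters `β₁`, `β₂`. -/
structure Params where
  γ : ℝ
  v : ℝ
  ε : ℝ
  β₁ : ℝ
  β₂ : ℝ

/-- The parameters `γ = η / √T` and `β₂ = 1 - 1/T` calibrated to the horizon `T`. -/
def horizonParams (v ε β₁ η : ℝ) (T : ℕ) : Params where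
  γ := η / Real.sqrt T
  v := v
  ε := ε
  β₁ := β₁
  β₂ := 1 - 1 / (T : ℝ)

/-- The state after `t` iterations: the iterate `x_{t+1}`, the first moment `m_t` and the second
moment `v_t`. -/
structure State (d : ℕ) where
  x : EuclideanSpace ℝ (Fin d)
  m : Fin d → ℝ
  v : Fin d → ℝ

variable {d : ℕ} {Z : Type*}

/-- The coordinatewise preconditioner `γ (√w + ε)⁻¹` at the second moment `w`. -/
def Params.precond (p : Params) (w : Fin d → ℝ) (i : Fin d) : ℝ :=
  p.γ * (Real.sqrt (w i) + p.ε)⁻¹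

/-- One iteration of Adam from the state `(x_t, m_{t-1}, v_{t-1})` with stochastic gradient `g_t`. -/
def Params.step (p : Params) (s : State d) (g : EuclideanSpace ℝ (Fin d)) : State d :=
  let m' : Fin d → ℝ := fun i => p.β₁ * s.m i + (1 - p.β₁) * g i
  let v' : Fin d → ℝ := fun i => p.β₂ * s.v i + (1 - p.β₂) * (g i * g i)
  { x := WithLp.toLp 2 fun i => s.x i - p.precond v' i * m' i
    m := m'
    v := v' }

/-- The Adam trajectory with oracle `g`, initial point `x₁` and samples `ζ 1, ζ 2, …`
(`ζ 0` is not used): `adam p g x₁ ζ t` is `(x_{t+1}, m_t, v_t)`. -/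
def adam (p : Params) (g : EuclideanSpace ℝ (Fin d) → Z → EuclideanSpace ℝ (Fin d))
    (x₁ : EuclideanSpace ℝ (Fin d)) (ζ : ℕ → Z) : ℕ → State d
  | 0 => { x := x₁, m := fun _ => 0, v := fun _ => p.v }
  | t + 1 =>
      let s := adam p g x₁ ζ t
      p.step s (g s.x (ζ (t + 1)))

/-- The iterate `x_t`, for `t ≥ 1`. -/
def iterate (p : Params) (g : EuclideanSpace ℝ (Fin d) → Z → EuclideanSpace ℝ (Fin d))
    (x₁ : EuclideanSpace ℝ (Fin d)) (ζ : ℕ → Z) (t : ℕ) : EuclideanSpace ℝ (Fin d) :=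
  (adam p g x₁ ζ (t - 1)).x

/-- The stochastic gradient `g_t = g(x_t; z_t)`, for `t ≥ 1`. -/
def stochGrad (p : Params) (g : EuclideanSpace ℝ (Fin d) → Z → EuclideanSpace ℝ (Fin d))
    (x₁ : EuclideanSpace ℝ (Fin d)) (ζ : ℕ → Z) (t : ℕ) : EuclideanSpace ℝ (Fin d) :=
  g (iterate p g x₁ ζ t) (ζ t)

/-- The coordinatewise step size `γ_{t,i} = γ (√v_{t,i} + ε)⁻¹`. -/
def stepSize (p : Params) (g : EuclideanSpace ℝ (Fin d) → Z → EuclideanSpace ℝ (Fin d))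
    (x₁ : EuclideanSpace ℝ (Fin d)) (ζ : ℕ → Z) (t : ℕ) (i : Fin d) : ℝ :=
  p.precond (adam p g x₁ ζ t).v i

/-- The adaptive gradient energy `∑_{t=1}^T ∑_i γ_{t,i} (∇f(x_t))_i²`. -/
def energy (f : EuclideanSpace ℝ (Fin d) → ℝ) (p : Params)
    (g : EuclideanSpace ℝ (Fin d) → Z → EuclideanSpace ℝ (Fin d))
    (x₁ : EuclideanSpace ℝ (Fin d)) (ζ : ℕ → Z) (T : ℕ) : ℝ :=
  ∑ t ∈ Finset.Icc 1 T, ∑ i : Fin d,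
    stepSize p g x₁ ζ t i * (gradient f (iterate p g x₁ ζ t) i) ^ 2

/-- The canonical σ-algebra `σ(z_1, …, z_t)`. -/
@[reducible]
def history {Ω : Type*} [MeasurableSpace Z] (z : ℕ → Ω → Z) (t : ℕ) : MeasurableSpace Ω :=
  ⨆ s ∈ Finset.Icc 1 t, MeasurableSpace.comap (z s) inferInstance

open MeasureTheory in
/-- Conditional unbiasedness and conditional variance at most `C` of the stochastic gradients
`g_1, …, g_T` along the Adam trajectory. The square integrability of the noise says that the
conditional variance is a genuine one; it is implied by its bound. -/
def BoundedVariance {Ω : Type*} [MeasurableSpace Ω] [MeasurableSpace Z] (μ : Measure Ω)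
    (f : EuclideanSpace ℝ (Fin d) → ℝ) (p : Params)
    (g : EuclideanSpace ℝ (Fin d) → Z → EuclideanSpace ℝ (Fin d))
    (x₁ : EuclideanSpace ℝ (Fin d)) (z : ℕ → Ω → Z) (T : ℕ) (C : ℝ) : Prop :=
  ∀ t : ℕ, 1 ≤ t → t ≤ T →
    MemLp (fun ω => stochGrad p g x₁ (fun s => z s ω) t
        - gradient f (iterate p g x₁ (fun s => z s ω) t)) 2 μ ∧
      condExp (history z (t - 1)) μ (fun ω => stochGrad p g x₁ (fun s => z s ω) t)
        =ᵐ[μ] (fun ω => gradient f (iterate p g x₁ (fun s => z s ω) t)) ∧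
      condExp (history z (t - 1)) μ (fun ω => ‖stochGrad p g x₁ (fun s => z s ω) t
        - gradient f (iterate p g x₁ (fun s => z s ω) t)‖ ^ 2) ≤ᵐ[μ] fun _ => C

/-- The shifted objective `f̄ = f - inf f + 1`. -/
def fbar (f : EuclideanSpace ℝ (Fin d) → ℝ) (x : EuclideanSpace ℝ (Fin d)) : ℝ :=
  f x - (⨅ y, f y) + 1

/-- `D_{β₁}`, with `D_{β₁}² = 4 (1 - β₁) sup_{T ≥ 10} ∑_{r=0}^{T-1} (T β₁ / (T - 1))^r`. -/
def Dconst (β₁ : ℝ) : ℝ :=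
  Real.sqrt (4 * (1 - β₁) *
    ⨆ T : {T : ℕ // 10 ≤ T}, ∑ r ∈ Finset.range T, ((T : ℝ) * β₁ / ((T : ℝ) - 1)) ^ r)

/-- `l = exp (L β₁² d D_{β₁}² / (1 - β₁)²)`. -/
def lconst (d : ℕ) (L β₁ : ℝ) : ℝ :=
  Real.exp (L * β₁ ^ 2 * d * Dconst β₁ ^ 2 / (1 - β₁) ^ 2)

/-- `B₀ = 2 (1 + 2L / (√v + ε)) f̄(x₁)`, as a function of `F = f̄(x₁)`. -/
def Bconst (L v ε F : ℝ) : ℝ :=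
  2 * (1 + 2 * L / (Real.sqrt v + ε)) * F

/-- The right-hand side of the high-probability bound. -/
def energyBound (l B₀ U δ : ℝ) : ℝ :=
  16 * max
    (max (Real.log (24 * l * (1 + Real.exp (2 * (6 : ℝ) ^ (1 / 6 : ℝ) * B₀ ^ (1 / 6 : ℝ))) / δ) ^ 6)
      ((2 * Real.log (24 * l / δ)) ^ 6))
    (max ((300 : ℝ) ^ 6) ((2 * Real.log (24 * l * U ^ 2 / δ)) ^ 6))

end AdamEnergy

end

/-! Write ρ = 1 - 1/T, y = x - β₁/(1-β₁) γ m, r = √f̄(y), and let Λ be the sum over the coordinates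
of log(v_t / (ρ v_{t-1})). The increment of y is -P + β₁/(1-β₁) D with P = γ_t g_t and D = (γ_{t-1}
- γ_t) m_{t-1}. Since ‖∇f‖ is at most a multiple of √f̄, passing to r divides the first order errors
by something comparable to the gradient, and r changes by -X plus O(Λ + u + d/T) (`rad_step_le`).
Here X is the decrease ⟨∇f(x), P⟩/(2r) and u is the normalized momentum energy. Subtracting a
multiple of Σ log(v/ρⁿ) and adding a multiple of u gives `lyapunov`, which absorbs the Λ and u
errors, keeps a spare term -Q²Λ, Q being `slopeConst`, and still drifts by O(d/T).

The decrease obeys |X| ≤ Q√d and X² ≤ Q²Λ (`abs_decrease_le`). At a small rate l the spare term pays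
for the second order part of exp(-lX), so the exponential Lyapunov function is multiplied by at most
(1 - lX) exp(O(d/T)), which is affine in X (`exp_lyapunov_step_le`). Expanding X around the exact
gradient (`neg_decrease_le`) leaves a linear noise term of conditional mean zero and a quadratic one
with coefficient O(1/T). Hence a bound on the conditional variance suffices to make `expWeight` a
supermartingale, whose total compensation over the horizon does not depend on T. It also carries the
accumulated exact decrease.

The maximal inequality `mul_measureReal_exists_le` bounds `expWeight` by O(1/δ) at all times,
outside an event of probability δ/2. To recover r and the accumulated decrease, the subtracted
logarithms must be bounded. The rate is chosen so that they cost at most log √`mass`. As r² is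
dominated by exp(lr), hence by a multiple of `expWeight` times √`mass`, each step raises √`mass` by
at most 9/T times a multiple of `expWeight` plus the squared noise (`sqrt_mass_step_le`). Markov's
inequality then bounds √`mass` by O(1/δ), outside a second event of probability δ/2.

Off both events r and the accumulated decrease are O(1 + log(1/δ)). The energy is at most cubic in
such a bound (`energy_le`), and the sixth power on the right dominates the cubic
(`cubic_le_energyBound`). -/

noncomputable section

namespace AdamEnergy

/-! ### Scalar estimates for one coordinate: preconditioner, second moment, momentum. -/

section Coordinates

/-- The horizon discount `1 - 1/T` raised to a power at most `T` stays above `1/9`. -/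
lemma one_ninth_le_discount_pow {T n : ℕ} (hT : 10 ≤ T) (hn : n ≤ T) :
    1 / 9 ≤ (1 - 1 / (T : ℝ)) ^ n := by
  have hT' : (10 : ℝ) ≤ T := by exact_mod_cast hT
  have hρ : 0 < 1 - 1 / (T : ℝ) := by
    rw [sub_pos, div_lt_one] <;> linarith
  have hρ1 : 1 - 1 / (T : ℝ) ≤ 1 := by
    have : 0 ≤ 1 / (T : ℝ) := by positivity
    linarith
  refine le_trans ?_ (pow_le_pow_of_le_one hρ.le hρ1 hn)
  -- From log ρ ≥ 1 - 1/ρ = -1/(T-1) ≥ -2/T. The T-th power is then at least e⁻², and e² < 9.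
  have h1 : -(2 / (T : ℝ)) ≤ Real.log (1 - 1 / (T : ℝ)) := by
    refine le_trans ?_ (Real.one_sub_inv_le_log_of_pos hρ)
    have : (1 - 1 / (T : ℝ))⁻¹ = 1 + 1 / ((T : ℝ) - 1) := by
      have : (T : ℝ) - 1 ≠ 0 := by linarith
      field_simp
      ring
    rw [this]
    have : 1 / ((T : ℝ) - 1) ≤ 2 / (T : ℝ) := by
      rw [div_le_div_iff₀] <;> linarith
    linarith
  have h2 : Real.exp (-2) ≤ (1 - 1 / (T : ℝ)) ^ T := by
    rw [← Real.exp_log hρ, ← Real.exp_nat_mul]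
    apply Real.exp_le_exp.2
    have := mul_le_mul_of_nonneg_left h1 (by linarith : (0 : ℝ) ≤ T)
    have e : (T : ℝ) * (2 / T) = 2 := by field_simp
    linarith
  refine le_trans ?_ h2
  rw [Real.exp_neg, one_div]
  apply inv_anti₀ (Real.exp_pos _)
  have : Real.exp 2 = Real.exp 1 * Real.exp 1 := by rw [← Real.exp_add]; norm_num
  rw [this]
  nlinarith [Real.exp_one_lt_d9, Real.exp_pos 1]

/-- Rationalize: the difference of the squares is b(g-G)(g+G), and √b|g+G| is at most the sum of the
two roots. -/
lemma abs_sqrt_sub_sqrt_le {a b : ℝ} (ha : 0 < a) (hb : 0 < b) (g G : ℝ) :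
    |√(a + b * g ^ 2) - √(a + b * G ^ 2)| ≤ √b * |g - G| := by
  have hb' := Real.sq_sqrt hb.le
  have e1 := Real.sq_sqrt (by positivity : 0 ≤ a + b * g ^ 2)
  have e2 := Real.sq_sqrt (by positivity : 0 ≤ a + b * G ^ 2)
  have p1 : √b * |g| ≤ √(a + b * g ^ 2) := by
    apply Real.le_sqrt_of_sq_le
    rw [mul_pow, sq_abs, hb']; linarith
  have p2 : √b * |G| ≤ √(a + b * G ^ 2) := by
    apply Real.le_sqrt_of_sq_le
    rw [mul_pow, sq_abs, hb']; linarith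
  have q1 : 0 < √(a + b * g ^ 2) := Real.sqrt_pos.2 (by positivity)
  have q2 : 0 < √(a + b * G ^ 2) := Real.sqrt_pos.2 (by positivity)
  set S := √(a + b * g ^ 2)
  set S' := √(a + b * G ^ 2)
  have hs : 0 < S + S' := by positivity
  have key : |S - S'| * (S + S') ≤ √b * |g - G| * (S + S') := by
    have : |S - S'| * (S + S') = √b * |g - G| * (√b * |g + G|) := by
      rw [← abs_of_pos hs, ← abs_mul]
      have : (S - S') * (S + S') = b * ((g - G) * (g + G)) := by linear_combination e1 - e2
      rw [this, abs_mul, abs_mul, abs_of_pos hb]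
      linear_combination (-|g - G| * |g + G|) * hb'
    rw [this]
    gcongr
    calc √b * |g + G| ≤ √b * (|g| + |G|) := by gcongr; exact abs_add_le g G
      _ ≤ S + S' := by linarith
  exact le_of_mul_le_mul_right key hs

/-- The derivative at `G` of the preconditioned gradient `g ↦ g / (√(a + b g²) + ε)`. -/
def precondSlope (a b ε G : ℝ) : ℝ :=
  (√(a + b * G ^ 2) + ε)⁻¹ - G * (√(a + b * G ^ 2) + ε)⁻¹ ^ 2 * (b * G / √(a + b * G ^ 2))

/-- The root is at least √b|g|. This boundedness, however large g is, keeps the constants of the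
expansion below independent of g and G. -/
lemma abs_mul_inv_sqrt_le {a b ε : ℝ} (ha : 0 < a) (hb : 0 < b) (hε : 0 < ε) (g : ℝ) :
    √b * |g * (√(a + b * g ^ 2) + ε)⁻¹| ≤ 1 := by
  have q1 : 0 < √(a + b * g ^ 2) := Real.sqrt_pos.2 (by positivity)
  have p1 : √b * |g| ≤ √(a + b * g ^ 2) := by
    apply Real.le_sqrt_of_sq_le
    rw [mul_pow, sq_abs, Real.sq_sqrt hb.le]; linarith
  rw [abs_mul, abs_of_pos (by positivity : 0 < (√(a + b * g ^ 2) + ε)⁻¹), ← mul_assoc,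
    ← div_eq_mul_inv, div_le_one (by positivity)]
  linarith

lemma abs_mul_div_sqrt_le {a b : ℝ} (ha : 0 < a) (hb : 0 < b) (G : ℝ) :
    |b * G / √(a + b * G ^ 2)| ≤ √b := by
  have q1 : 0 < √(a + b * G ^ 2) := Real.sqrt_pos.2 (by positivity)
  have p1 : √b * |G| ≤ √(a + b * G ^ 2) := by
    apply Real.le_sqrt_of_sq_le
    rw [mul_pow, sq_abs, Real.sq_sqrt hb.le]; linarith
  rw [abs_div, abs_of_pos q1, div_le_iff₀ q1, abs_mul, abs_of_pos hb]
  calc b * |G| = √b * (√b * |G|) := by rw [← mul_assoc, Real.mul_self_sqrt hb.le]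
    _ ≤ _ := by gcongr

lemma abs_precondSlope_le {a b ε : ℝ} (ha : 0 < a) (hb : 0 < b) (hε : 0 < ε) (G : ℝ) :
    |precondSlope a b ε G| ≤ 2 / ε := by
  have h1 := abs_mul_inv_sqrt_le ha hb hε G
  have h2 := abs_mul_div_sqrt_le ha hb G
  have hψ : 0 < (√(a + b * G ^ 2) + ε)⁻¹ := by positivity
  have hψ' : (√(a + b * G ^ 2) + ε)⁻¹ ≤ ε⁻¹ :=
    inv_anti₀ hε (by linarith [Real.sqrt_nonneg (a + b * G ^ 2)])
  unfold precondSlope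
  set ψ := (√(a + b * G ^ 2) + ε)⁻¹
  set σ := b * G / √(a + b * G ^ 2)
  calc |ψ - G * ψ ^ 2 * σ| ≤ |ψ| + |G * ψ ^ 2 * σ| := abs_sub _ _
    _ = ψ + |G * ψ| * |σ| * ψ := by
        rw [abs_of_pos hψ, ← abs_mul, ← abs_of_pos hψ, ← abs_mul, abs_of_pos hψ]
        ring_nf
    _ ≤ ψ + |G * ψ| * √b * ψ := by gcongr
    _ ≤ ψ + 1 * ψ := by gcongr; linarith
    _ ≤ 2 / ε := by rw [div_eq_mul_inv]; linarith

/-- Second order expansion of the preconditioned gradient `g ↦ g / (√(a + b g²) + ε)`. -/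
lemma precond_second_order {a b ε : ℝ} (ha : 0 < a) (hb : 0 < b) (hε : 0 < ε) (g G : ℝ) :
    |g * (√(a + b * g ^ 2) + ε)⁻¹ - G * (√(a + b * G ^ 2) + ε)⁻¹
        - precondSlope a b ε G * (g - G)|
      ≤ √b * (2 / (ε * √a) + 2 / ε ^ 2) * (g - G) ^ 2 := by
  have hS := abs_sqrt_sub_sqrt_le ha hb g G
  have h1 := abs_mul_inv_sqrt_le ha hb hε g
  have h2 := abs_mul_div_sqrt_le ha hb G
  have e1 := Real.sq_sqrt (by positivity : 0 ≤ a + b * g ^ 2)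
  have e2 := Real.sq_sqrt (by positivity : 0 ≤ a + b * G ^ 2)
  have q1 : 0 < √(a + b * g ^ 2) := Real.sqrt_pos.2 (by positivity)
  have q2 : 0 < √(a + b * G ^ 2) := Real.sqrt_pos.2 (by positivity)
  have p2 : √b * |G| ≤ √(a + b * G ^ 2) := by
    apply Real.le_sqrt_of_sq_le
    rw [mul_pow, sq_abs, Real.sq_sqrt hb.le]; linarith
  have ha2 : √a ≤ √(a + b * G ^ 2) := Real.sqrt_le_sqrt (by nlinarith [sq_nonneg G])
  have ha1 : √a ≤ √(a + b * g ^ 2) := Real.sqrt_le_sqrt (by nlinarith [sq_nonneg g])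
  have hsa : 0 < √a := Real.sqrt_pos.2 ha
  have hsb : 0 < √b := Real.sqrt_pos.2 hb
  have hbb : √b * √b = b := Real.mul_self_sqrt hb.le
  unfold precondSlope
  set S := √(a + b * g ^ 2)
  set S' := √(a + b * G ^ 2)
  set h := g - G with hh
  set ψ := (S + ε)⁻¹ with hψd
  set ψ' := (S' + ε)⁻¹ with hψd'
  set σ := b * G / S' with hσ
  have hψ : 0 < ψ := by positivity
  have hψ' : 0 < ψ' := by positivity
  have hψe' : ψ' ≤ ε⁻¹ := inv_anti₀ hε (by linarith)
  have hdiff : ψ - ψ' = ψ * ψ' * (S' - S) := by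
    rw [hψd, hψd']; field_simp; ring
  -- σ is the derivative of G ↦ √(a + bG²), so this is the first order Taylor remainder of the root.
  have bracket : |S' - S + σ * h| ≤ 2 * b * h ^ 2 / √a := by
    have e : S' - S + σ * h = -(b * h * (h * S' - G * (S - S')) / ((S + S') * S')) := by
      have hs : S + S' ≠ 0 := by positivity
      rw [hσ, hh]
      field_simp
      linear_combination (-S') * e1 + S' * e2
    rw [e, abs_neg, abs_div, abs_of_pos (by positivity : 0 < (S + S') * S'),
      div_le_div_iff₀ (by positivity) hsa]
    have t : |h * S' - G * (S - S')| ≤ 2 * (|h| * S') := by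
      calc |h * S' - G * (S - S')| ≤ |h * S'| + |G * (S - S')| := abs_sub _ _
        _ = |h| * S' + |G| * |S - S'| := by rw [abs_mul, abs_mul, abs_of_pos q2]
        _ ≤ |h| * S' + |G| * (√b * |h|) := by gcongr
        _ = |h| * S' + (√b * |G|) * |h| := by ring
        _ ≤ |h| * S' + S' * |h| := by gcongr
        _ = _ := by ring
    rw [abs_mul, abs_mul, abs_of_pos hb]
    calc b * |h| * |h * S' - G * (S - S')| * √a ≤ b * |h| * (2 * (|h| * S')) * (S + S') := by
          gcongr; linarith
      _ = 2 * b * |h| ^ 2 * ((S + S') * S') := by ring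
      _ = _ := by rw [sq_abs]
  have lip : |G * ψ' - g * ψ| ≤ 2 * |h| / ε := by
    have e : G * ψ' - g * ψ = -(h * ψ') + (g * ψ) * ψ' * (S - S') := by
      rw [hh]; linear_combination (-g) * hdiff
    rw [e]
    calc |-(h * ψ') + g * ψ * ψ' * (S - S')| ≤ |-(h * ψ')| + |g * ψ * ψ' * (S - S')| :=
          abs_add_le _ _
      _ = |h| * ψ' + |g * ψ| * ψ' * |S - S'| := by
          rw [abs_neg, abs_mul, abs_mul _ (S - S'), abs_mul _ ψ', abs_of_pos hψ']
      _ ≤ |h| * ψ' + |g * ψ| * ψ' * (√b * |h|) := by gcongr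
      _ = |h| * ψ' + (√b * |g * ψ|) * ψ' * |h| := by ring
      _ ≤ |h| * ψ' + 1 * ψ' * |h| := by gcongr
      _ = 2 * |h| * ψ' := by ring
      _ ≤ 2 * |h| * ε⁻¹ := by gcongr
      _ = _ := by rw [div_eq_mul_inv]
  -- The remainder splits into the Taylor remainder of the root, weighted by the bounded gψ, and σh
  -- times the variation of g ↦ gψ. Both are quadratic in h.
  have e : g * ψ - G * ψ' - (ψ' - G * ψ' ^ 2 * σ) * h
      = (g * ψ) * ψ' * (S' - S + σ * h) + σ * h * ψ' * (G * ψ' - g * ψ) := by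
    rw [hh]; linear_combination g * hdiff
  rw [e]
  calc |(g * ψ) * ψ' * (S' - S + σ * h) + σ * h * ψ' * (G * ψ' - g * ψ)|
      ≤ |(g * ψ) * ψ' * (S' - S + σ * h)| + |σ * h * ψ' * (G * ψ' - g * ψ)| := abs_add_le _ _
    _ = |g * ψ| * ψ' * |S' - S + σ * h| + |σ| * |h| * ψ' * |G * ψ' - g * ψ| := by
        simp only [abs_mul, abs_of_pos hψ']
    _ ≤ |g * ψ| * ψ' * (2 * b * h ^ 2 / √a) + √b * |h| * ψ' * (2 * |h| / ε) := by gcongr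
    _ = (√b * |g * ψ|) * ψ' * (2 * √b * h ^ 2 / √a) + √b * ψ' * (2 * |h| ^ 2 / ε) := by
        linear_combination (-(|g * ψ| * ψ' * (2 * h ^ 2 / √a))) * hbb
    _ ≤ 1 * ε⁻¹ * (2 * √b * h ^ 2 / √a) + √b * ε⁻¹ * (2 * |h| ^ 2 / ε) := by gcongr
    _ = _ := by rw [sq_abs]; field_simp

lemma discount_pos {T : ℕ} (hT : 10 ≤ T) : 0 < 1 - 1 / (T : ℝ) := by
  have hT' : (10 : ℝ) ≤ T := by exact_mod_cast hT
  rw [sub_pos, div_lt_one] <;> linarith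

lemma discount_le_one (T : ℕ) : 1 - 1 / (T : ℝ) ≤ 1 := by
  have : 0 ≤ 1 / (T : ℝ) := by positivity
  linarith

/-- The updated second moment dominates the discounted one. -/
lemma discount_mul_le_secondMoment (T : ℕ) (v g : ℝ) :
    (1 - 1 / (T : ℝ)) * v ≤ (1 - 1 / (T : ℝ)) * v + 1 / (T : ℝ) * g ^ 2 := by
  have : 0 ≤ 1 / (T : ℝ) * g ^ 2 := by positivity
  linarith

section Coordinate

variable {T : ℕ} {η ε v w g : ℝ}

lemma secondMoment_pos (hT : 10 ≤ T) (hv : 0 < v)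
    (hw : w = (1 - 1 / (T : ℝ)) * v + 1 / (T : ℝ) * g ^ 2) : 0 < w := by
  have h := discount_mul_le_secondMoment T v g
  have := mul_pos (discount_pos hT) hv
  linarith

lemma relativeGrowth_eq (hT : 10 ≤ T) (hv : 0 < v)
    (hw : w = (1 - 1 / (T : ℝ)) * v + 1 / (T : ℝ) * g ^ 2) :
    1 - (1 - 1 / (T : ℝ)) * v / w = 1 / (T : ℝ) * g ^ 2 / w := by
  have := (secondMoment_pos hT hv hw).ne'
  rw [eq_div_iff this, sub_mul, div_mul_cancel₀ _ this]
  linarith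

/-- An instance of 1 - 1/x ≤ log x. The left side is the share of the fresh g² in the second moment;
the right side telescopes along the trajectory once v is divided by ρⁿ. -/
lemma relativeGrowth_le_log (hT : 10 ≤ T) (hv : 0 < v) (hw : 0 < w) :
    1 - (1 - 1 / (T : ℝ)) * v / w ≤ Real.log (w / ((1 - 1 / (T : ℝ)) * v)) := by
  have h := mul_pos (discount_pos hT) hv
  have := Real.one_sub_inv_le_log_of_pos (div_pos hw h)
  rwa [inv_div] at this

lemma relativeGrowth_le_one (hT : 10 ≤ T) (hv : 0 < v) (hw : 0 < w) :
    1 - (1 - 1 / (T : ℝ)) * v / w ≤ 1 := by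
  have := div_pos (mul_pos (discount_pos hT) hv) hw
  linarith

lemma sq_stepSize_mul_le (hT : 10 ≤ T) (hη : 0 < η) (hη1 : η ≤ 1) (hε : 0 < ε) (hw : 0 < w)
    (m : ℝ) : (η / √T * (√w + ε)⁻¹ * m) ^ 2 ≤ 1 / (T : ℝ) * m ^ 2 / w := by
  have hT' : (10 : ℝ) ≤ T := by exact_mod_cast hT
  have hsw : 0 < √w := Real.sqrt_pos.2 hw
  have e : (η / √T * (√w + ε)⁻¹ * m) ^ 2 = (η ^ 2 / T * m ^ 2) * ((√w + ε) ^ 2)⁻¹ := by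
    rw [mul_pow, mul_pow, div_pow, Real.sq_sqrt (by linarith), inv_pow]; ring
  rw [e, div_eq_mul_inv _ w]
  gcongr
  · exact pow_le_one₀ hη.le hη1
  · calc w = √w ^ 2 := (Real.sq_sqrt hw.le).symm
      _ ≤ _ := by gcongr; linarith

/-- The ratio (√v+ε)/(√w+ε) falls short of 1 by at most the logarithmic growth, and because w ≥ ρv
it exceeds 1 by at most 2/T. The minimum with 1 later makes the square of this error linear in the
growth. -/
lemma abs_stepSize_sub_mul_le (hT : 10 ≤ T) (hη : 0 < η) (hε : 0 < ε) (hv : 0 < v)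
    (hw : w = (1 - 1 / (T : ℝ)) * v + 1 / (T : ℝ) * g ^ 2) (m : ℝ) :
    |(η / √T * (√v + ε)⁻¹ - η / √T * (√w + ε)⁻¹) * m|
      ≤ |η / √T * (√v + ε)⁻¹ * m|
        * min 1 (Real.log (w / ((1 - 1 / (T : ℝ)) * v)) + 2 / T) := by
  have hT' : (10 : ℝ) ≤ T := by exact_mod_cast hT
  have hw0 := secondMoment_pos hT hv hw
  have hρ := discount_pos hT
  have hρ1 := discount_le_one T
  have hdl := relativeGrowth_le_log hT hv hw0
  have hdl0 : 0 ≤ Real.log (w / ((1 - 1 / (T : ℝ)) * v)) := by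
    refine le_trans ?_ hdl
    rw [relativeGrowth_eq hT hv hw]; positivity
  have hsv : 0 < √v := Real.sqrt_pos.2 hv
  have hsw : 0 < √w := Real.sqrt_pos.2 hw0
  have e : (η / √T * (√v + ε)⁻¹ - η / √T * (√w + ε)⁻¹) * m
      = (η / √T * (√v + ε)⁻¹ * m) * (1 - (√v + ε) / (√w + ε)) := by
    field_simp
  rw [e, abs_mul]
  gcongr
  have ht : 0 < (√v + ε) / (√w + ε) := by positivity
  have hup : (√v + ε) / (√w + ε) - 1 ≤ 2 / T := by
    have h1 : (1 - 1 / (T : ℝ)) * (√v + ε) ≤ √w + ε := by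
      have : (1 - 1 / (T : ℝ)) * √v ≤ √w := by
        apply Real.le_sqrt_of_sq_le
        rw [mul_pow, Real.sq_sqrt hv.le]
        have := discount_mul_le_secondMoment T v g
        nlinarith
      nlinarith
    have h2 : (1 + 2 / (T : ℝ)) * (1 - 1 / (T : ℝ)) ≥ 1 := by
      have : (1 + 2 / (T : ℝ)) * (1 - 1 / (T : ℝ)) = 1 + (1 / T) * (1 - 2 / T) := by
        field_simp; ring
      rw [this]
      have h3 : 2 / (T : ℝ) ≤ 1 := by rw [div_le_one] <;> linarith
      have : 0 ≤ (1 / (T : ℝ)) * (1 - 2 / T) := mul_nonneg (by positivity) (by linarith)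
      linarith
    rw [sub_le_iff_le_add, div_le_iff₀ (by positivity)]
    calc √v + ε ≤ ((1 + 2 / (T : ℝ)) * (1 - 1 / (T : ℝ))) * (√v + ε) :=
          le_mul_of_one_le_left (by positivity) h2
      _ = (1 + 2 / (T : ℝ)) * ((1 - 1 / (T : ℝ)) * (√v + ε)) := by ring
      _ ≤ (1 + 2 / (T : ℝ)) * (√w + ε) := by gcongr
      _ = _ := by ring
  have hlow : 1 - (√v + ε) / (√w + ε) ≤ Real.log (w / ((1 - 1 / (T : ℝ)) * v)) := by
    rcases le_total w v with h | h
    · refine le_trans ?_ hdl0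
      rw [sub_nonpos, one_le_div (by positivity)]
      linarith [Real.sqrt_le_sqrt h]
    · refine le_trans ?_ hdl
      have h1 : v / w ≤ (√v + ε) / (√w + ε) := by
        rw [div_le_div_iff₀ hw0 (by positivity)]
        have hs := Real.sqrt_le_sqrt h
        have e1 := Real.sq_sqrt hv.le
        have e2 := Real.sq_sqrt hw0.le
        nlinarith [mul_nonneg (mul_nonneg hsv.le hsw.le) (sub_nonneg.2 hs)]
      have h2 : (1 - 1 / (T : ℝ)) * v / w ≤ v / w := by
        gcongr
        nlinarith
      linarith
  have h2T : 2 / (T : ℝ) ≤ 1 := by rw [div_le_one] <;> linarith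
  have h2T0 : 0 ≤ 2 / (T : ℝ) := by positivity
  apply le_min <;> rw [abs_le] <;> constructor <;> linarith

/-- The normalized momentum energy `ρⁿ m² / (T v)`. -/
def momentumRatio (T n : ℕ) (m v : ℝ) : ℝ :=
  (1 - 1 / (T : ℝ)) ^ n * (m ^ 2 / (T * v))

lemma momentumRatio_nonneg (hT : 10 ≤ T) (hv : 0 < v) (n : ℕ) (m : ℝ) :
    0 ≤ momentumRatio T n m v := by
  have := discount_pos hT
  unfold momentumRatio; positivity

/-- Convexity of the square separates old momentum from fresh gradient. The extra discount in
`momentumRatio` offsets the possible shrinking w ≥ ρv in the old part and is dropped in the fresh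
part. -/
lemma momentumRatio_succ_le {β m : ℝ} (hT : 10 ≤ T) (hv : 0 < v)
    (hw : w = (1 - 1 / (T : ℝ)) * v + 1 / (T : ℝ) * g ^ 2) (hβ : 0 ≤ β) (hβ1 : β < 1) (n : ℕ) :
    momentumRatio T (n + 1) (β * m + (1 - β) * g) w
      ≤ β * momentumRatio T n m v + (1 - β) * (1 - (1 - 1 / (T : ℝ)) * v / w) := by
  have hT' : (10 : ℝ) ≤ T := by exact_mod_cast hT
  have hT0 : (0 : ℝ) < T := by linarith
  have hw0 := secondMoment_pos hT hv hw
  have hρ := discount_pos hT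
  have hρ1 := discount_le_one T
  have hle : (1 - 1 / (T : ℝ)) * v ≤ w := hw ▸ discount_mul_le_secondMoment T v g
  rw [relativeGrowth_eq hT hv hw]
  unfold momentumRatio
  set ρ := 1 - 1 / (T : ℝ)
  have hsq : (β * m + (1 - β) * g) ^ 2 ≤ β * m ^ 2 + (1 - β) * g ^ 2 := by
    nlinarith [mul_nonneg (mul_nonneg hβ (sub_nonneg.2 hβ1.le)) (sq_nonneg (m - g))]
  have h1 : ρ ^ (n + 1) * (m ^ 2 / (T * w)) ≤ ρ ^ n * (m ^ 2 / (T * v)) := by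
    rw [pow_succ, mul_assoc]
    gcongr
    rw [← mul_div_assoc, div_le_div_iff₀ (by positivity) (by positivity)]
    calc ρ * m ^ 2 * (T * v) = m ^ 2 * T * (ρ * v) := by ring
      _ ≤ m ^ 2 * T * w := by gcongr
      _ = _ := by ring
  have h2 : ρ ^ (n + 1) * (g ^ 2 / (T * w)) ≤ 1 / (T : ℝ) * g ^ 2 / w := by
    calc ρ ^ (n + 1) * (g ^ 2 / (T * w)) ≤ 1 * (g ^ 2 / (T * w)) := by
          gcongr; exact pow_le_one₀ hρ.le hρ1
      _ = _ := by field_simp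
  calc ρ ^ (n + 1) * ((β * m + (1 - β) * g) ^ 2 / (T * w))
      ≤ ρ ^ (n + 1) * ((β * m ^ 2 + (1 - β) * g ^ 2) / (T * w)) := by gcongr
    _ = β * (ρ ^ (n + 1) * (m ^ 2 / (T * w))) + (1 - β) * (ρ ^ (n + 1) * (g ^ 2 / (T * w))) := by
        ring
    _ ≤ _ := by
        gcongr

/-- The 9 is the price of removing the factor ρⁿ, which is at least 1/9 within the horizon. -/
lemma sq_stepSize_mul_le_momentumRatio {n : ℕ} (hT : 10 ≤ T) (hn : n ≤ T) (hη : 0 < η)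
    (hη1 : η ≤ 1) (hε : 0 < ε) (hv : 0 < v) (m : ℝ) :
    (η / √T * (√v + ε)⁻¹ * m) ^ 2 ≤ 9 * momentumRatio T n m v := by
  refine (sq_stepSize_mul_le hT hη hη1 hε hv m).trans ?_
  have h := one_ninth_le_discount_pow hT hn
  have hT' : (10 : ℝ) ≤ T := by exact_mod_cast hT
  have hT0 : (0 : ℝ) < T := by linarith
  unfold momentumRatio
  have h0 : 0 ≤ m ^ 2 / (T * v) := by positivity
  have : 1 / (T : ℝ) * m ^ 2 / v = m ^ 2 / (T * v) := by field_simp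
  rw [this]
  nlinarith

end Coordinate

end Coordinates

/-! ### Smooth functions and the square-root potential. -/

section Smoothness

section Smooth

variable {E : Type*} [NormedAddCommGroup E] [InnerProductSpace ℝ E] [CompleteSpace E]
  {f : E → ℝ} {L : ℝ}

open scoped InnerProductSpace

/-- Descent inequality for a function with `L`-Lipschitz gradient. -/
lemma le_add_inner_gradient (hf : Differentiable ℝ f)
    (hL : 0 ≤ L) (hlip : ∀ x y, ‖gradient f x - gradient f y‖ ≤ L * ‖x - y‖) (x y : E) :
    f y ≤ f x + ⟪gradient f x, y - x⟫_ℝ + L * ‖y - x‖ ^ 2 := by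
  -- The mean value theorem, used in place of integration along the segment, gives the constant L
  -- instead of L/2.
  obtain ⟨z, hz, hfz⟩ := domain_mvt (s := Set.univ) (f := f) (f' := fderiv ℝ f) (x := x) (y := y)
    (fun z _ => (hf z).hasFDerivAt.hasFDerivWithinAt) convex_univ trivial trivial
  rw [← inner_gradient_left] at hfz
  have hzx : ‖z - x‖ ≤ ‖y - x‖ := by
    obtain ⟨t, ht, rfl⟩ := (segment_eq_image' ℝ x y) ▸ hz
    simp only [add_sub_cancel_left, norm_smul, Real.norm_eq_abs, abs_of_nonneg ht.1]
    exact mul_le_of_le_one_left (norm_nonneg _) ht.2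
  have h1 : ⟪gradient f z - gradient f x, y - x⟫_ℝ ≤ L * ‖y - x‖ ^ 2 :=
    calc ⟪gradient f z - gradient f x, y - x⟫_ℝ
        ≤ ‖gradient f z - gradient f x‖ * ‖y - x‖ := real_inner_le_norm _ _
      _ ≤ (L * ‖y - x‖) * ‖y - x‖ := by
          gcongr
          exact (hlip z x).trans (by gcongr)
      _ = _ := by ring
  rw [inner_sub_left] at h1
  linarith

/-- The square of the gradient norm is controlled by the optimality gap. -/
lemma sq_norm_gradient_le (hf : Differentiable ℝ f) (hL : 0 < L)
    (hlip : ∀ x y, ‖gradient f x - gradient f y‖ ≤ L * ‖x - y‖) (hb : BddBelow (Set.range f))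
    (x : E) : ‖gradient f x‖ ^ 2 ≤ 4 * L * (f x - ⨅ y, f y) := by
  -- The step length 1/(2L) minimizes the quadratic upper bound along the negative gradient.
  have h1 := le_add_inner_gradient hf hL.le hlip x (x - (2 * L)⁻¹ • gradient f x)
  have h2 := ciInf_le hb (x - (2 * L)⁻¹ • gradient f x)
  rw [sub_sub_cancel_left, inner_neg_right, inner_smul_right, real_inner_self_eq_norm_sq, norm_neg,
    norm_smul, mul_pow, Real.norm_eq_abs, sq_abs] at h1
  have h3 : L * ((2 * L)⁻¹ ^ 2 * ‖gradient f x‖ ^ 2) = (4 * L)⁻¹ * ‖gradient f x‖ ^ 2 := by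
    field_simp; ring
  have h4 : (2 * L)⁻¹ * ‖gradient f x‖ ^ 2 = 2 * ((4 * L)⁻¹ * ‖gradient f x‖ ^ 2) := by
    field_simp; ring
  have h5 : (4 * L)⁻¹ * ‖gradient f x‖ ^ 2 ≤ f x - ⨅ y, f y := by linarith
  rwa [inv_mul_le_iff₀ (by positivity)] at h5

end Smooth

variable {d : ℕ} {f : EuclideanSpace ℝ (Fin d) → ℝ} {L : ℝ}

open scoped InnerProductSpace

lemma one_le_fbar (hb : BddBelow (Set.range f)) (x : EuclideanSpace ℝ (Fin d)) :
    1 ≤ fbar f x := by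
  have := ciInf_le hb x
  unfold fbar; linarith

lemma one_le_sqrt_fbar (hb : BddBelow (Set.range f)) (x : EuclideanSpace ℝ (Fin d)) :
    1 ≤ √(fbar f x) :=
  Real.one_le_sqrt.2 (one_le_fbar hb x)

lemma norm_gradient_le_sqrt_fbar (hf : Differentiable ℝ f) (hL : 0 < L)
    (hlip : ∀ x y, ‖gradient f x - gradient f y‖ ≤ L * ‖x - y‖) (hb : BddBelow (Set.range f))
    (x : EuclideanSpace ℝ (Fin d)) : ‖gradient f x‖ ≤ 2 * √L * √(fbar f x) := by
  apply le_of_sq_le_sq _ (by positivity)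
  rw [mul_pow, mul_pow, Real.sq_sqrt hL.le, Real.sq_sqrt (by linarith [one_le_fbar hb x])]
  have := sq_norm_gradient_le hf hL hlip hb x
  unfold fbar
  nlinarith

/-- One step of the square-root potential along a perturbed gradient displacement. -/
lemma sqrt_fbar_step (hf : Differentiable ℝ f) (hL : 0 < L)
    (hlip : ∀ x y, ‖gradient f x - gradient f y‖ ≤ L * ‖x - y‖) (hb : BddBelow (Set.range f))
    {b : ℝ} (hb0 : 0 ≤ b) {x y y' P M D : EuclideanSpace ℝ (Fin d)}
    (hx : x - y = b • M) (hy : y' - y = -P + b • D) :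
    √(fbar f y') ≤ √(fbar f y) - ⟪gradient f x, P⟫_ℝ / (2 * √(fbar f y))
      + L * b / 4 * (‖M‖ ^ 2 + ‖P‖ ^ 2) + b * √L * ‖D‖ + L * ‖P‖ ^ 2 + L * b ^ 2 * ‖D‖ ^ 2 := by
  have hr := one_le_sqrt_fbar hb y
  have hr2 := Real.sq_sqrt (by linarith [one_le_fbar hb y] : 0 ≤ fbar f y)
  have hr2' := Real.sq_sqrt (by linarith [one_le_fbar hb y'] : 0 ≤ fbar f y')
  have hG := norm_gradient_le_sqrt_fbar hf hL hlip hb y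
  have hdesc := le_add_inner_gradient hf hL.le hlip y y'
  have hgap : fbar f y' - fbar f y = f y' - f y := by unfold fbar; ring
  set r := √(fbar f y)
  set r' := √(fbar f y')
  have h2r : 0 < 2 * r := by linarith
  have hΔ : ‖y' - y‖ ^ 2 ≤ 2 * ‖P‖ ^ 2 + 2 * b ^ 2 * ‖D‖ ^ 2 := by
    rw [hy]
    have h1 : ‖-P + b • D‖ ≤ ‖P‖ + b * ‖D‖ := by
      refine (norm_add_le _ _).trans ?_
      rw [norm_neg, norm_smul, Real.norm_eq_abs, abs_of_nonneg hb0]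
    have h2 : ‖-P + b • D‖ ^ 2 ≤ (‖P‖ + b * ‖D‖) ^ 2 := by gcongr
    nlinarith [sq_nonneg (‖P‖ - b * ‖D‖)]
  have hcross : ⟪gradient f x - gradient f y, P⟫_ℝ ≤ L * b / 2 * (‖M‖ ^ 2 + ‖P‖ ^ 2) := by
    calc ⟪gradient f x - gradient f y, P⟫_ℝ ≤ ‖gradient f x - gradient f y‖ * ‖P‖ :=
          real_inner_le_norm _ _
      _ ≤ (L * (b * ‖M‖)) * ‖P‖ := by
          gcongr
          refine (hlip x y).trans ?_
          rw [hx, norm_smul, Real.norm_eq_abs, abs_of_nonneg hb0]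
      _ = L * b / 2 * (2 * ‖M‖ * ‖P‖) := by ring
      _ ≤ _ := by
          gcongr
          nlinarith [sq_nonneg (‖M‖ - ‖P‖)]
  -- The gradient at y is at most a multiple of r, so after division by 2r the first order term in D
  -- has a constant coefficient.
  have hD : ⟪gradient f y, D⟫_ℝ ≤ 2 * r * (√L * ‖D‖) := by
    calc ⟪gradient f y, D⟫_ℝ ≤ ‖gradient f y‖ * ‖D‖ := real_inner_le_norm _ _
      _ ≤ (2 * √L * r) * ‖D‖ := by gcongr
      _ = _ := by ring
  have hin : ⟪gradient f y, y' - y⟫_ℝ = -⟪gradient f x, P⟫_ℝ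
      + ⟪gradient f x - gradient f y, P⟫_ℝ + b * ⟪gradient f y, D⟫_ℝ := by
    rw [hy, inner_add_right, inner_neg_right, inner_smul_right, inner_sub_left]; ring
  -- Here r'² - r² = 2r(r'-r) + (r'-r)². Errors lacking a factor r receive one from r ≥ 1 before 2r
  -- is cancelled.
  have hroot : 2 * r * (r' - r) ≤ f y' - f y := by
    rw [← hgap, ← hr2, ← hr2']
    nlinarith [sq_nonneg (r' - r)]
  have e : 2 * r * (⟪gradient f x, P⟫_ℝ / (2 * r)) = ⟪gradient f x, P⟫_ℝ := by
    field_simp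
  have hMP : 0 ≤ L * b / 4 * (‖M‖ ^ 2 + ‖P‖ ^ 2) := by positivity
  have hP : 0 ≤ L * ‖P‖ ^ 2 := by positivity
  have hDD : 0 ≤ L * b ^ 2 * ‖D‖ ^ 2 := by positivity
  have hbD := mul_le_mul_of_nonneg_left hD hb0
  have hLΔ := mul_le_mul_of_nonneg_left hΔ hL.le
  have key : 2 * r * (r' - r) ≤ 2 * r * (- (⟪gradient f x, P⟫_ℝ / (2 * r))
      + L * b / 4 * (‖M‖ ^ 2 + ‖P‖ ^ 2) + b * √L * ‖D‖ + L * ‖P‖ ^ 2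
      + L * b ^ 2 * ‖D‖ ^ 2) := by
    have g1 := mul_le_mul_of_nonneg_left hr hMP
    have g2 := mul_le_mul_of_nonneg_left hr hP
    have g3 := mul_le_mul_of_nonneg_left hr hDD
    rw [mul_add, mul_add, mul_add, mul_add, mul_neg, e]
    nlinarith
  have := le_of_mul_le_mul_left key h2r
  linarith

end Smoothness

/-! ### One Adam step of the square-root potential, and the constants. -/

section OneStep

open scoped InnerProductSpace

variable {d : ℕ} {f : EuclideanSpace ℝ (Fin d) → ℝ} {L v ε β₁ η : ℝ} {T n : ℕ} {s : State d}

/-- The auxiliary point `x - β₁/(1-β₁) γ m`, whose increments do not involve the fresh momentum. -/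
def Params.auxPoint (p : Params) (s : State d) : EuclideanSpace ℝ (Fin d) :=
  WithLp.toLp 2 fun i => s.x i - p.β₁ / (1 - p.β₁) * (p.precond s.v i * s.m i)

/-- The square root of the shifted objective at the auxiliary point. -/
def rad (f : EuclideanSpace ℝ (Fin d) → ℝ) (p : Params) (s : State d) : ℝ :=
  √(fbar f (p.auxPoint s))

/-- The normalized first order decrease when the stochastic gradient equals `g`. -/
def decrease (f : EuclideanSpace ℝ (Fin d) → ℝ) (p : Params) (s : State d)
    (g : EuclideanSpace ℝ (Fin d)) : ℝ :=
  (∑ i, gradient f s.x i * (p.precond (p.step s g).v i * g i)) / (2 * rad f p s)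

/-- The normalized first order decrease for the exact gradient. -/
def exactDecrease (f : EuclideanSpace ℝ (Fin d) → ℝ) (p : Params) (s : State d) : ℝ :=
  decrease f p s (gradient f s.x)

/-- The logarithmic growth of the second moment at coordinate `i`. -/
def logGrowth (T : ℕ) (p : Params) (s : State d) (g : EuclideanSpace ℝ (Fin d)) (i : Fin d) : ℝ :=
  Real.log ((p.step s g).v i / ((1 - 1 / (T : ℝ)) * s.v i))

/-- Bounds on the state after `n` iterations that hold along every trajectory. -/
structure Admissible (v : ℝ) (T n : ℕ) (s : State d) : Prop where
  lower : ∀ i, (1 - 1 / (T : ℝ)) ^ n * v ≤ s.v i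
  ratio : ∀ i, momentumRatio T n (s.m i) (s.v i) ≤ 1

lemma horizonParams_precond (w : Fin d → ℝ) (i : Fin d) :
    (horizonParams v ε β₁ η T).precond w i = η / √T * (√(w i) + ε)⁻¹ := rfl

lemma step_v_apply (g : EuclideanSpace ℝ (Fin d)) (i : Fin d) :
    ((horizonParams v ε β₁ η T).step s g).v i
      = (1 - 1 / (T : ℝ)) * s.v i + 1 / (T : ℝ) * g i ^ 2 := by
  simp only [Params.step, horizonParams]; ring

lemma step_m_apply (g : EuclideanSpace ℝ (Fin d)) (i : Fin d) :
    ((horizonParams v ε β₁ η T).step s g).m i = β₁ * s.m i + (1 - β₁) * g i := rfl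

lemma Admissible.v_pos (hs : Admissible v T n s) (hT : 10 ≤ T) (hv : 0 < v) (i : Fin d) :
    0 < s.v i :=
  lt_of_lt_of_le (mul_pos (pow_pos (discount_pos hT) n) hv) (hs.lower i)

lemma Admissible.step (hs : Admissible v T n s) (hT : 10 ≤ T) (hv : 0 < v) (hβ : 0 ≤ β₁)
    (hβ1 : β₁ < 1) (g : EuclideanSpace ℝ (Fin d)) :
    Admissible v T (n + 1) ((horizonParams v ε β₁ η T).step s g) where
  lower i := by
    rw [step_v_apply]
    refine le_trans ?_ (discount_mul_le_secondMoment T _ _)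
    rw [pow_succ', mul_assoc]
    exact mul_le_mul_of_nonneg_left (hs.lower i) (discount_pos hT).le
  ratio i := by
    rw [step_m_apply]
    have hvi := hs.v_pos hT hv i
    have hw := step_v_apply (v := v) (ε := ε) (β₁ := β₁) (η := η) (T := T) (s := s) g i
    refine (momentumRatio_succ_le hT hvi hw hβ hβ1 n).trans ?_
    have h1 := relativeGrowth_le_one hT hvi (secondMoment_pos hT hvi hw)
    have h2 := hs.ratio i
    nlinarith

lemma admissible_adam {Z : Type*} (hT : 10 ≤ T) (hv : 0 < v) (hβ : 0 ≤ β₁) (hβ1 : β₁ < 1)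
    (g : EuclideanSpace ℝ (Fin d) → Z → EuclideanSpace ℝ (Fin d)) (x₁ : EuclideanSpace ℝ (Fin d))
    (ζ : ℕ → Z) (n : ℕ) : Admissible v T n (adam (horizonParams v ε β₁ η T) g x₁ ζ n) := by
  induction n with
  | zero =>
    constructor
    · intro i; simp [adam, horizonParams]
    · intro i; simp [adam, momentumRatio]
  | succ n ih => exact ih.step hT hv hβ hβ1 _

lemma logGrowth_nonneg (hT : 10 ≤ T) (hvi : ∀ i, 0 < s.v i) (g : EuclideanSpace ℝ (Fin d))
    (i : Fin d) : 0 ≤ logGrowth T (horizonParams v ε β₁ η T) s g i := by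
  have hw := step_v_apply (v := v) (ε := ε) (β₁ := β₁) (η := η) (T := T) (s := s) g i
  have hw0 := secondMoment_pos hT (hvi i) hw
  refine le_trans ?_ (relativeGrowth_le_log hT (hvi i) hw0)
  rw [relativeGrowth_eq hT (hvi i) hw]
  positivity

lemma sq_precond_mul_le (hT : 10 ≤ T) (hη : 0 < η) (hη1 : η ≤ 1) (hε : 0 < ε)
    (hvi : ∀ i, 0 < s.v i) (g : EuclideanSpace ℝ (Fin d)) (i : Fin d) :
    ((horizonParams v ε β₁ η T).precond ((horizonParams v ε β₁ η T).step s g).v i * g i) ^ 2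
      ≤ min 1 (logGrowth T (horizonParams v ε β₁ η T) s g i) := by
  have hw := step_v_apply (v := v) (ε := ε) (β₁ := β₁) (η := η) (T := T) (s := s) g i
  have hw0 := secondMoment_pos hT (hvi i) hw
  have h := sq_stepSize_mul_le hT hη hη1 hε hw0 (g i)
  rw [← relativeGrowth_eq hT (hvi i) hw] at h
  rw [horizonParams_precond]
  exact le_min (h.trans (relativeGrowth_le_one hT (hvi i) hw0))
    (h.trans (relativeGrowth_le_log hT (hvi i) hw0))

lemma norm_le_sum_abs (x : EuclideanSpace ℝ (Fin d)) : ‖x‖ ≤ ∑ i, |x i| := by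
  apply le_of_sq_le_sq _ (Finset.sum_nonneg fun i _ => abs_nonneg _)
  rw [EuclideanSpace.real_norm_sq_eq]
  calc ∑ i, x i ^ 2 = ∑ i, |x i| ^ 2 := by simp
    _ ≤ _ := Finset.sum_sq_le_sq_sum_of_nonneg fun i _ => abs_nonneg _

section Constants

variable (d : ℕ) (L v ε β₁ : ℝ)

/-- Bound on the drift of the square-root potential. -/
def driftConst : ℝ :=
  3 * L * (β₁ / (1 - β₁)) + 6 * (β₁ / (1 - β₁)) * √L + L + 18 * L * (β₁ / (1 - β₁)) ^ 2

/-- Bound on the gradient at the iterate relative to the square-root potential. -/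
def slopeConst : ℝ := 1 + √L + 2 * L * (β₁ / (1 - β₁)) * √d

/-- Weight of the logarithmic potential. -/
def logWeight : ℝ := 2 * driftConst L β₁ + slopeConst d L β₁ ^ 2

/-- Rate of the exponential Lyapunov function. -/
def expRate : ℝ := 1 / (2 * (1 + slopeConst d L β₁ * √d + logWeight d L β₁ * d))

/-- Curvature bound of the preconditioned gradient. -/
def curvConst : ℝ := 2 / (ε * √(v / 9)) + 2 / ε ^ 2

variable {L β₁}

lemma momentumFactor_nonneg (hβ : 0 ≤ β₁) (hβ1 : β₁ < 1) : 0 ≤ β₁ / (1 - β₁) :=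
  div_nonneg hβ (by linarith)

lemma driftConst_pos (hL : 0 < L) (hβ : 0 ≤ β₁) (hβ1 : β₁ < 1) : 0 < driftConst L β₁ := by
  have := momentumFactor_nonneg hβ hβ1
  unfold driftConst; positivity

lemma one_le_slopeConst (hL : 0 < L) (hβ : 0 ≤ β₁) (hβ1 : β₁ < 1) :
    1 ≤ slopeConst d L β₁ := by
  have := momentumFactor_nonneg hβ hβ1
  have : 0 ≤ √L + 2 * L * (β₁ / (1 - β₁)) * √d := by positivity
  unfold slopeConst; linarith

lemma logWeight_pos (hL : 0 < L) (hβ : 0 ≤ β₁) (hβ1 : β₁ < 1) : 0 < logWeight d L β₁ := by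
  have := driftConst_pos hL hβ hβ1
  unfold logWeight; positivity

lemma expRate_pos (hL : 0 < L) (hβ : 0 ≤ β₁) (hβ1 : β₁ < 1) : 0 < expRate d L β₁ := by
  have h1 := logWeight_pos d hL hβ hβ1
  have h2 := one_le_slopeConst d hL hβ hβ1
  unfold expRate; positivity

lemma expRate_mul (hL : 0 < L) (hβ : 0 ≤ β₁) (hβ1 : β₁ < 1) :
    expRate d L β₁ + expRate d L β₁ * (slopeConst d L β₁ * √d)
      + expRate d L β₁ * (logWeight d L β₁ * d) = 1 / 2 := by
  have h1 := logWeight_pos d hL hβ hβ1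
  have h2 := one_le_slopeConst d hL hβ hβ1
  have : 0 < 1 + slopeConst d L β₁ * √d + logWeight d L β₁ * d := by positivity
  unfold expRate
  field_simp

/-- Three uses of the small rate l: 2l ≤ 1 lets lQ²Λ pay for 2(lX)²; the second bound gives |lX| ≤
1/2; the third makes the logarithmic potential cost at most half of log `mass`. -/
lemma expRate_bounds (hL : 0 < L) (hβ : 0 ≤ β₁) (hβ1 : β₁ < 1) :
    expRate d L β₁ ≤ 1 / 2 ∧ expRate d L β₁ * (slopeConst d L β₁ * √d) ≤ 1 / 2 ∧
      expRate d L β₁ * (logWeight d L β₁ * d) ≤ 1 / 2 := by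
  have h := expRate_mul d hL hβ hβ1
  have h1 := logWeight_pos d hL hβ hβ1
  have h2 := one_le_slopeConst d hL hβ hβ1
  have h3 := expRate_pos d hL hβ hβ1
  have h4 : 0 ≤ expRate d L β₁ * (slopeConst d L β₁ * √d) := by positivity
  have h5 : 0 ≤ expRate d L β₁ * (logWeight d L β₁ * d) := by positivity
  refine ⟨?_, ?_, ?_⟩ <;> linarith

end Constants

lemma sq_precond_mul_momentum_le
    (hv : 0 < v) (hε : 0 < ε) (hη : 0 < η) (hη1 : η ≤ 1) (hT : 10 ≤ T)
    (hs : Admissible v T n s) (hn : n ≤ T) (i : Fin d) :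
    ((horizonParams v ε β₁ η T).precond s.v i * s.m i) ^ 2
      ≤ 9 * momentumRatio T n (s.m i) (s.v i) := by
  rw [horizonParams_precond]
  exact sq_stepSize_mul_le_momentumRatio hT hn hη hη1 hε (hs.v_pos hT hv i) _

lemma abs_precond_mul_momentum_le
    (hv : 0 < v) (hε : 0 < ε) (hη : 0 < η) (hη1 : η ≤ 1) (hT : 10 ≤ T)
    (hs : Admissible v T n s) (hn : n ≤ T) (i : Fin d) :
    |(horizonParams v ε β₁ η T).precond s.v i * s.m i| ≤ 3 := by
  apply abs_le_of_sq_le_sq _ (by norm_num)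
  have := sq_precond_mul_momentum_le (β₁ := β₁) hv hε hη hη1 hT hs hn i
  linarith [hs.ratio i]

/-- The gradient at the iterate is controlled by the square-root potential. -/
lemma norm_gradient_le_rad
    (hf : Differentiable ℝ f) (hlip : ∀ x y, ‖gradient f x - gradient f y‖ ≤ L * ‖x - y‖)
    (hb : BddBelow (Set.range f)) (hL : 0 < L) (hv : 0 < v) (hε : 0 < ε) (hβ : 0 ≤ β₁)
    (hβ1 : β₁ < 1) (hη : 0 < η) (hη1 : η ≤ 1) (hT : 10 ≤ T)
    (hs : Admissible v T n s) (hn : n ≤ T) :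
    ‖gradient f s.x‖ ≤ 2 * slopeConst d L β₁ * rad f (horizonParams v ε β₁ η T) s := by
  have hb0 := momentumFactor_nonneg hβ hβ1
  set p := horizonParams v ε β₁ η T with hp
  have hr : 1 ≤ rad f p s := one_le_sqrt_fbar hb _
  have h1 : ‖gradient f (p.auxPoint s)‖ ≤ 2 * √L * rad f p s :=
    norm_gradient_le_sqrt_fbar hf hL hlip hb _
  have h2 : ‖s.x - p.auxPoint s‖ ≤ β₁ / (1 - β₁) * (3 * √d) := by
    have e : s.x - p.auxPoint s
        = (β₁ / (1 - β₁)) • (WithLp.toLp 2 fun i => p.precond s.v i * s.m i :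
          EuclideanSpace ℝ (Fin d)) := by
      ext i
      simp [Params.auxPoint, hp, horizonParams]
    rw [e, norm_smul, Real.norm_eq_abs, abs_of_nonneg hb0]
    gcongr
    apply le_of_sq_le_sq _ (by positivity)
    rw [EuclideanSpace.real_norm_sq_eq, mul_pow, Real.sq_sqrt (by positivity)]
    calc ∑ i, (p.precond s.v i * s.m i) ^ 2 ≤ ∑ _i : Fin d, (9 : ℝ) := by
          apply Finset.sum_le_sum
          intro i _
          have := sq_precond_mul_momentum_le (β₁ := β₁) hv hε hη hη1 hT hs hn i
          linarith [hs.ratio i]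
      _ = _ := by simp; ring
  have h3 := hlip s.x (p.auxPoint s)
  have h4 : ‖gradient f s.x‖ ≤ ‖gradient f (p.auxPoint s)‖
      + ‖gradient f s.x - gradient f (p.auxPoint s)‖ := by
    have := norm_add_le (gradient f (p.auxPoint s)) (gradient f s.x - gradient f (p.auxPoint s))
    rwa [add_sub_cancel] at this
  have h5 : L * ‖s.x - p.auxPoint s‖ ≤ L * (β₁ / (1 - β₁) * (3 * √d)) := by gcongr
  have h6 : 0 ≤ L * (β₁ / (1 - β₁)) * √d := by positivity
  unfold slopeConst
  nlinarith [mul_le_mul_of_nonneg_left hr h6]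

/-- One step of the square-root potential along Adam. -/
lemma rad_step_le
    (hf : Differentiable ℝ f) (hlip : ∀ x y, ‖gradient f x - gradient f y‖ ≤ L * ‖x - y‖)
    (hb : BddBelow (Set.range f)) (hL : 0 < L) (hv : 0 < v) (hε : 0 < ε) (hβ : 0 ≤ β₁)
    (hβ1 : β₁ < 1) (hη : 0 < η) (hη1 : η ≤ 1) (hT : 10 ≤ T)
    (hs : Admissible v T n s) (hn : n ≤ T) (g : EuclideanSpace ℝ (Fin d)) :
    rad f (horizonParams v ε β₁ η T) ((horizonParams v ε β₁ η T).step s g)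
      ≤ rad f (horizonParams v ε β₁ η T) s - decrease f (horizonParams v ε β₁ η T) s g
        + driftConst L β₁ * (∑ i, logGrowth T (horizonParams v ε β₁ η T) s g i)
        + driftConst L β₁ * (∑ i, momentumRatio T n (s.m i) (s.v i))
        + driftConst L β₁ * (d / T) := by
  have hT' : (10 : ℝ) ≤ T := by exact_mod_cast hT
  have hb0 := momentumFactor_nonneg hβ hβ1
  have hvi := hs.v_pos hT hv
  have hM := sq_precond_mul_momentum_le (β₁ := β₁) hv hε hη hη1 hT hs hn
  have hM3 := abs_precond_mul_momentum_le (β₁ := β₁) hv hε hη hη1 hT hs hn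
  have hP := sq_precond_mul_le (v := v) (β₁ := β₁) hT hη hη1 hε hvi g
  have hdl := logGrowth_nonneg (v := v) (ε := ε) (β₁ := β₁) (η := η) hT hvi g
  have hDi : ∀ i, |((horizonParams v ε β₁ η T).precond s.v i
      - (horizonParams v ε β₁ η T).precond ((horizonParams v ε β₁ η T).step s g).v i) * s.m i|
      ≤ 3 * min 1 (logGrowth T (horizonParams v ε β₁ η T) s g i + 2 / T) := by
    intro i
    have hw := step_v_apply (v := v) (ε := ε) (β₁ := β₁) (η := η) (T := T) (s := s) g i
    have := abs_stepSize_sub_mul_le hT hη hε (hvi i) hw (s.m i)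
    rw [horizonParams_precond, horizonParams_precond]
    refine this.trans ?_
    have h0 : 0 ≤ min 1 (logGrowth T (horizonParams v ε β₁ η T) s g i + 2 / T) :=
      le_min zero_le_one (add_nonneg (hdl i) (by positivity))
    exact mul_le_mul_of_nonneg_right (hM3 i) h0
  set p := horizonParams v ε β₁ η T with hp
  set P : EuclideanSpace ℝ (Fin d) := WithLp.toLp 2 fun i => p.precond (p.step s g).v i * g i
    with hPd
  set M : EuclideanSpace ℝ (Fin d) := WithLp.toLp 2 fun i => p.precond s.v i * s.m i with hMd
  set D : EuclideanSpace ℝ (Fin d) :=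
    WithLp.toLp 2 fun i => (p.precond s.v i - p.precond (p.step s g).v i) * s.m i with hDd
  have hx : s.x - p.auxPoint s = (β₁ / (1 - β₁)) • M := by
    ext i
    simp [Params.auxPoint, hp, horizonParams, hMd]
  -- With b = β₁/(1-β₁) one has (1+b)β₁ = b and (1+b)(1-β₁) = 1: the old momentum enters only
  -- through the change of preconditioner, and the fresh gradient has coefficient one.
  have hy : p.auxPoint (p.step s g) - p.auxPoint s = -P + (β₁ / (1 - β₁)) • D := by
    ext i
    have e : (1 - β₁) ≠ 0 := by linarith
    have h1 : (p.step s g).x i = s.x i - p.precond (p.step s g).v i * (p.step s g).m i := rfl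
    have h2 : (p.step s g).m i = β₁ * s.m i + (1 - β₁) * g i := rfl
    have h3 : p.β₁ = β₁ := rfl
    simp only [Params.auxPoint, hPd, hDd, PiLp.sub_apply, PiLp.add_apply, PiLp.neg_apply,
      PiLp.smul_apply, smul_eq_mul, h1, h2, h3]
    field_simp
    ring
  have hstep := sqrt_fbar_step hf hL hlip hb hb0 hx hy
  have hdec : ⟪gradient f s.x, P⟫_ℝ / (2 * √(fbar f (p.auxPoint s))) = decrease f p s g := by
    unfold decrease rad
    congr 1
    rw [PiLp.inner_apply]
    refine Finset.sum_congr rfl fun i _ => ?_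
    simp [hPd, mul_comm]
  rw [hdec] at hstep
  set Λ := ∑ i, logGrowth T p s g i with hΛ
  set u := ∑ i, momentumRatio T n (s.m i) (s.v i) with hu
  have hΛ0 : 0 ≤ Λ := Finset.sum_nonneg fun i _ => hdl i
  have hu0 : 0 ≤ u := Finset.sum_nonneg fun i _ => momentumRatio_nonneg hT (hvi i) _ _
  have hPn : ‖P‖ ^ 2 ≤ Λ := by
    rw [EuclideanSpace.real_norm_sq_eq]
    exact Finset.sum_le_sum fun i _ => (hP i).trans (min_le_right _ _)
  have hMn : ‖M‖ ^ 2 ≤ 9 * u := by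
    rw [EuclideanSpace.real_norm_sq_eq, hu, Finset.mul_sum]
    exact Finset.sum_le_sum fun i _ => hM i
  have hsum : ∑ i, (logGrowth T p s g i + 2 / T) = Λ + 2 * (d / T) := by
    rw [Finset.sum_add_distrib]
    simp
    ring
  have hDn : ‖D‖ ≤ 3 * (Λ + 2 * (d / T)) := by
    refine (norm_le_sum_abs D).trans ?_
    rw [← hsum, Finset.mul_sum]
    refine Finset.sum_le_sum fun i _ => (hDi i).trans ?_
    gcongr
    exact min_le_right _ _
  -- One factor of each squared minimum is bounded by 1, the other by the growth.
  have hDn2 : ‖D‖ ^ 2 ≤ 9 * (Λ + 2 * (d / T)) := by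
    rw [EuclideanSpace.real_norm_sq_eq, ← hsum, Finset.mul_sum]
    refine Finset.sum_le_sum fun i _ => ?_
    have h0 : 0 ≤ logGrowth T p s g i + 2 / T := add_nonneg (hdl i) (by positivity)
    have h1 : 0 ≤ min 1 (logGrowth T p s g i + 2 / T) := le_min zero_le_one h0
    calc D i ^ 2 = |D i| ^ 2 := (sq_abs _).symm
      _ ≤ (3 * min 1 (logGrowth T p s g i + 2 / T)) ^ 2 := by
          gcongr
          exact hDi i
      _ = 9 * (min 1 (logGrowth T p s g i + 2 / T) * min 1 (logGrowth T p s g i + 2 / T)) := by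
          ring
      _ ≤ 9 * (1 * (logGrowth T p s g i + 2 / T)) := by
          gcongr
          · exact min_le_left _ _
          · exact min_le_right _ _
      _ = _ := by ring
  have hdT : 0 ≤ (d : ℝ) / T := by positivity
  set b := β₁ / (1 - β₁)
  have k1 : L * b / 4 * (‖M‖ ^ 2 + ‖P‖ ^ 2) ≤ L * b / 4 * (9 * u + Λ) := by gcongr
  have k2 : b * √L * ‖D‖ ≤ b * √L * (3 * (Λ + 2 * (d / T))) := by gcongr
  have k3 : L * ‖P‖ ^ 2 ≤ L * Λ := by gcongr
  have k4 : L * b ^ 2 * ‖D‖ ^ 2 ≤ L * b ^ 2 * (9 * (Λ + 2 * (d / T))) := by gcongr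
  -- The four summands match the error terms `k1` to `k4`, each rounded up so that their sum
  -- dominates the coefficients of Λ, u and d/T alike.
  have hA : driftConst L β₁ = 3 * L * b + 6 * b * √L + L + 18 * L * b ^ 2 := rfl
  rw [hA]
  unfold rad
  have c1 : 0 ≤ L * b * u := by positivity
  have c2 : 0 ≤ L * b * Λ := by positivity
  have c3 : 0 ≤ L * b * (d / T) := by positivity
  have c4 : 0 ≤ b * √L * u := by positivity
  have c5 : 0 ≤ b * √L * Λ := by positivity
  have c7 : 0 ≤ L * b ^ 2 * u := by positivity
  have c8 : 0 ≤ L * b ^ 2 * Λ := by positivity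
  have c9 : 0 ≤ L * u := by positivity
  have c10 : 0 ≤ L * (d / T : ℝ) := by positivity
  nlinarith

end OneStep

/-! ### The Lyapunov function, its exponential, and linearization in the noise. -/

section Lyapunov

open scoped InnerProductSpace

variable {d : ℕ} {f : EuclideanSpace ℝ (Fin d) → ℝ} {L v ε β₁ η : ℝ} {T n : ℕ} {s : State d}

/-- The Lyapunov function after `n` iterations, without the accumulated decrease. -/
def lyapunov (f : EuclideanSpace ℝ (Fin d) → ℝ) (L v ε β₁ η : ℝ) (T n : ℕ) (s : State d) : ℝ :=
  rad f (horizonParams v ε β₁ η T) s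
    - logWeight d L β₁ * ∑ i, Real.log (s.v i / (1 - 1 / (T : ℝ)) ^ n)
    + driftConst L β₁ / (1 - β₁) * ∑ i, momentumRatio T n (s.m i) (s.v i)

/-- The coefficient of the noise in the linearized decrease. -/
def noiseCoeff (f : EuclideanSpace ℝ (Fin d) → ℝ) (v ε β₁ η : ℝ) (T : ℕ) (s : State d) :
    EuclideanSpace ℝ (Fin d) :=
  WithLp.toLp 2 fun i => -(gradient f s.x i / (2 * rad f (horizonParams v ε β₁ η T) s)
    * (η / √T * precondSlope ((1 - 1 / (T : ℝ)) * s.v i) (1 / (T : ℝ)) ε (gradient f s.x i)))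

lemma abs_apply_le_norm (x : EuclideanSpace ℝ (Fin d)) (i : Fin d) : |x i| ≤ ‖x‖ :=
  PiLp.norm_apply_le x i

lemma exactDecrease_nonneg
    (hb : BddBelow (Set.range f)) (hε : 0 < ε) (hη : 0 < η)
    : 0 ≤ exactDecrease f (horizonParams v ε β₁ η T) s := by
  unfold exactDecrease decrease
  have hr : 1 ≤ rad f (horizonParams v ε β₁ η T) s := one_le_sqrt_fbar hb _
  refine div_nonneg (Finset.sum_nonneg fun i _ => ?_) (by linarith)
  rw [horizonParams_precond]
  have : 0 ≤ η / √T * (√(((horizonParams v ε β₁ η T).step s (gradient f s.x)).v i) + ε)⁻¹ := by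
    positivity
  nlinarith [mul_nonneg this (mul_self_nonneg (gradient f s.x i))]

/-- Cauchy–Schwarz, with the gradient over 2r bounded by `slopeConst`. The squared coordinates of
the preconditioned gradient are at most min(1, log growth), and the two sides of this minimum give
the two bounds. -/
lemma abs_decrease_le
    (hf : Differentiable ℝ f) (hlip : ∀ x y, ‖gradient f x - gradient f y‖ ≤ L * ‖x - y‖)
    (hb : BddBelow (Set.range f)) (hL : 0 < L) (hv : 0 < v) (hε : 0 < ε) (hβ : 0 ≤ β₁)
    (hβ1 : β₁ < 1) (hη : 0 < η) (hη1 : η ≤ 1) (hT : 10 ≤ T)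
    (hs : Admissible v T n s) (hn : n ≤ T) (g : EuclideanSpace ℝ (Fin d)) :
    |decrease f (horizonParams v ε β₁ η T) s g| ≤ slopeConst d L β₁ * √d ∧
    decrease f (horizonParams v ε β₁ η T) s g ^ 2 ≤
      slopeConst d L β₁ ^ 2 * ∑ i, logGrowth T (horizonParams v ε β₁ η T) s g i := by
  have hvi := hs.v_pos hT hv
  have hG := norm_gradient_le_rad hf hlip hb hL hv hε hβ hβ1 hη hη1 hT hs hn
  have hP := sq_precond_mul_le (v := v) (β₁ := β₁) hT hη hη1 hε hvi g
  have hQ := one_le_slopeConst d hL hβ hβ1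
  set p := horizonParams v ε β₁ η T with hp
  have hr : 1 ≤ rad f p s := one_le_sqrt_fbar hb _
  set P : EuclideanSpace ℝ (Fin d) := WithLp.toLp 2 fun i => p.precond (p.step s g).v i * g i
    with hPd
  have hdec : decrease f p s g = ⟪gradient f s.x, P⟫_ℝ / (2 * rad f p s) := by
    unfold decrease
    congr 1
    rw [PiLp.inner_apply]
    refine Finset.sum_congr rfl fun i _ => ?_
    simp [hPd, mul_comm]
  have habs : |decrease f p s g| ≤ slopeConst d L β₁ * ‖P‖ := by
    rw [hdec, abs_div, abs_of_pos (by linarith : 0 < 2 * rad f p s), div_le_iff₀ (by linarith)]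
    calc |⟪gradient f s.x, P⟫_ℝ| ≤ ‖gradient f s.x‖ * ‖P‖ := abs_real_inner_le_norm _ _
      _ ≤ (2 * slopeConst d L β₁ * rad f p s) * ‖P‖ := by gcongr
      _ = _ := by ring
  constructor
  · refine habs.trans ?_
    gcongr
    apply Real.le_sqrt_of_sq_le
    rw [EuclideanSpace.real_norm_sq_eq]
    calc ∑ i, P i ^ 2 ≤ ∑ _i : Fin d, (1 : ℝ) :=
          Finset.sum_le_sum fun i _ => (hP i).trans (min_le_left _ _)
      _ = d := by simp
  · rw [← sq_abs]
    calc |decrease f p s g| ^ 2 ≤ (slopeConst d L β₁ * ‖P‖) ^ 2 := by gcongr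
      _ = slopeConst d L β₁ ^ 2 * ‖P‖ ^ 2 := by ring
      _ ≤ _ := by
        gcongr
        rw [EuclideanSpace.real_norm_sq_eq]
        exact Finset.sum_le_sum fun i _ => (hP i).trans (min_le_right _ _)

/-- With A = `driftConst`, the weight A/(1-β₁) makes the contraction of the momentum ratio cancel Au
while producing one more AΛ. The logarithmic weight 2A + Q² cancels both copies of AΛ and leaves
-Q²Λ for the exponential step. -/
lemma lyapunov_step_le
    (hf : Differentiable ℝ f) (hlip : ∀ x y, ‖gradient f x - gradient f y‖ ≤ L * ‖x - y‖)
    (hb : BddBelow (Set.range f)) (hL : 0 < L) (hv : 0 < v) (hε : 0 < ε) (hβ : 0 ≤ β₁)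
    (hβ1 : β₁ < 1) (hη : 0 < η) (hη1 : η ≤ 1) (hT : 10 ≤ T)
    (hs : Admissible v T n s) (hn : n ≤ T) (g : EuclideanSpace ℝ (Fin d)) :
    lyapunov f L v ε β₁ η T (n + 1) ((horizonParams v ε β₁ η T).step s g)
      ≤ lyapunov f L v ε β₁ η T n s - decrease f (horizonParams v ε β₁ η T) s g
        - slopeConst d L β₁ ^ 2 * (∑ i, logGrowth T (horizonParams v ε β₁ η T) s g i)
        + driftConst L β₁ * (d / T) := by
  have hvi := hs.v_pos hT hv
  have hstep := rad_step_le hf hlip hb hL hv hε hβ hβ1 hη hη1 hT hs hn g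
  have hρ := discount_pos hT
  have hA := driftConst_pos hL hβ hβ1
  set p := horizonParams v ε β₁ η T with hp
  have hw : ∀ i, (p.step s g).v i = (1 - 1 / (T : ℝ)) * s.v i + 1 / (T : ℝ) * g i ^ 2 :=
    fun i => step_v_apply g i
  have hlog : ∑ i, Real.log ((p.step s g).v i / (1 - 1 / (T : ℝ)) ^ (n + 1))
      = ∑ i, Real.log (s.v i / (1 - 1 / (T : ℝ)) ^ n) + ∑ i, logGrowth T p s g i := by
    rw [← Finset.sum_add_distrib]
    refine Finset.sum_congr rfl fun i _ => ?_
    have h1 := hvi i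
    have h2 := secondMoment_pos hT h1 (hw i)
    unfold logGrowth
    rw [← Real.log_mul (by positivity) (by positivity)]
    congr 1
    rw [pow_succ]
    set ρ := 1 - 1 / (T : ℝ)
    field_simp
  have hu : ∑ i, momentumRatio T (n + 1) ((p.step s g).m i) ((p.step s g).v i)
      ≤ β₁ * ∑ i, momentumRatio T n (s.m i) (s.v i) + (1 - β₁) * ∑ i, logGrowth T p s g i := by
    rw [Finset.mul_sum, Finset.mul_sum, ← Finset.sum_add_distrib]
    refine Finset.sum_le_sum fun i _ => ?_
    have h1 := hvi i
    have h2 := secondMoment_pos hT h1 (hw i)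
    refine (momentumRatio_succ_le hT h1 (hw i) hβ hβ1 n).trans ?_
    have := relativeGrowth_le_log hT h1 h2
    unfold logGrowth
    have : 0 < 1 - β₁ := by linarith
    gcongr
  unfold lyapunov
  rw [hlog]
  have h1β : 0 < 1 - β₁ := by linarith
  have hu2 := mul_le_mul_of_nonneg_left hu (by positivity : 0 ≤ driftConst L β₁ / (1 - β₁))
  set A := driftConst L β₁
  set Λ := ∑ i, logGrowth T p s g i
  set u := ∑ i, momentumRatio T n (s.m i) (s.v i)
  have e : A / (1 - β₁) * (β₁ * u + (1 - β₁) * Λ) = A / (1 - β₁) * u - A * u + A * Λ := by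
    field_simp; ring
  rw [e] at hu2
  have hW : logWeight d L β₁ = 2 * A + slopeConst d L β₁ ^ 2 := rfl
  rw [hW]
  linarith

/-- Pointwise multiplicative bound for the exponential Lyapunov function. -/
lemma exp_lyapunov_step_le
    (hf : Differentiable ℝ f) (hlip : ∀ x y, ‖gradient f x - gradient f y‖ ≤ L * ‖x - y‖)
    (hb : BddBelow (Set.range f)) (hL : 0 < L) (hv : 0 < v) (hε : 0 < ε) (hβ : 0 ≤ β₁)
    (hβ1 : β₁ < 1) (hη : 0 < η) (hη1 : η ≤ 1) (hT : 10 ≤ T)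
    (hs : Admissible v T n s) (hn : n ≤ T)
    (g : EuclideanSpace ℝ (Fin d)) :
    Real.exp (expRate d L β₁
        * lyapunov f L v ε β₁ η T (n + 1) ((horizonParams v ε β₁ η T).step s g))
      ≤ Real.exp (expRate d L β₁ * lyapunov f L v ε β₁ η T n s)
        * Real.exp (expRate d L β₁ * driftConst L β₁ * d / T)
        * (1 - expRate d L β₁ * decrease f (horizonParams v ε β₁ η T) s g) := by
  have hstep := lyapunov_step_le hf hlip hb hL hv hε hβ hβ1 hη hη1 hT hs hn g
  obtain ⟨hX1, hX2⟩ := abs_decrease_le hf hlip hb hL hv hε hβ hβ1 hη hη1 hT hs hn g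
  obtain ⟨hl1, hl2, -⟩ := expRate_bounds d hL hβ hβ1
  have hl := expRate_pos d hL hβ hβ1
  set l := expRate d L β₁
  set X := decrease f (horizonParams v ε β₁ η T) s g
  have hlX : |l * X| ≤ 1 / 2 := by
    rw [abs_mul, abs_of_pos hl]
    exact (mul_le_mul_of_nonneg_left hX1 hl.le).trans hl2
  have hlX' := abs_le.1 hlX
  have hpos : 0 < 1 - l * X := by linarith [hlX'.2]
  -- For y ≤ 1/2, log(1-y) ≥ -y/(1-y) ≥ -y - 2y². Replacing exp(-lX) by a factor affine in X
  -- dispenses with exponential moments of the noise.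
  have hlog : -(l * X) - 2 * (l * X) ^ 2 ≤ Real.log (1 - l * X) := by
    refine le_trans ?_ (Real.one_sub_inv_le_log_of_pos hpos)
    have : 1 - (1 - l * X)⁻¹ = -(l * X) / (1 - l * X) := by
      field_simp; ring
    rw [this, le_div_iff₀ hpos]
    nlinarith [mul_nonneg (sq_nonneg (l * X)) (by linarith [hlX'.2] : 0 ≤ 1 - 2 * (l * X))]
  have hexp : Real.exp (-(l * X) - 2 * (l * X) ^ 2) ≤ 1 - l * X :=
    (Real.le_log_iff_exp_le hpos).1 hlog
  refine le_trans ?_ (mul_le_mul_of_nonneg_left hexp (by positivity))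
  rw [← Real.exp_add, ← Real.exp_add]
  apply Real.exp_le_exp.2
  have h1 := mul_le_mul_of_nonneg_left hstep hl.le
  have h2 : 2 * (l * X) ^ 2 ≤ l * (slopeConst d L β₁ ^ 2
      * (∑ i, logGrowth T (horizonParams v ε β₁ η T) s g i)) := by
    calc 2 * (l * X) ^ 2 = l * (2 * l * X ^ 2) := by ring
      _ ≤ l * (1 * X ^ 2) := by gcongr; linarith
      _ ≤ _ := by rw [one_mul]; gcongr
  have e : l * driftConst L β₁ * d / T = l * (driftConst L β₁ * (d / T)) := by ring
  rw [e]
  nlinarith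

/-- Any deterministic bound will do: it makes the pairing with the noise integrable, so that its
integral vanishes. -/
lemma norm_noiseCoeff_le
    (hf : Differentiable ℝ f) (hlip : ∀ x y, ‖gradient f x - gradient f y‖ ≤ L * ‖x - y‖)
    (hb : BddBelow (Set.range f)) (hL : 0 < L) (hv : 0 < v) (hε : 0 < ε) (hβ : 0 ≤ β₁)
    (hβ1 : β₁ < 1) (hη : 0 < η) (hη1 : η ≤ 1) (hT : 10 ≤ T)
    (hs : Admissible v T n s) (hn : n ≤ T) :
    ‖noiseCoeff f v ε β₁ η T s‖ ≤ d * (slopeConst d L β₁ * (2 / ε)) := by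
  have hvi := hs.v_pos hT hv
  have hT' : (10 : ℝ) ≤ T := by exact_mod_cast hT
  have hG := norm_gradient_le_rad hf hlip hb hL hv hε hβ hβ1 hη hη1 hT hs hn
  have hQ := one_le_slopeConst d hL hβ hβ1
  have hr : 1 ≤ rad f (horizonParams v ε β₁ η T) s := one_le_sqrt_fbar hb _
  refine (norm_le_sum_abs _).trans ?_
  have : ∀ i, |noiseCoeff f v ε β₁ η T s i| ≤ slopeConst d L β₁ * (2 / ε) := by
    intro i
    simp only [noiseCoeff]
    rw [abs_neg, abs_mul]
    gcongr
    · rw [abs_div, abs_of_pos (by linarith : 0 < 2 * rad f (horizonParams v ε β₁ η T) s),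
        div_le_iff₀ (by linarith)]
      refine (abs_apply_le_norm _ i).trans (hG.trans (le_of_eq ?_))
      ring
    · have h1 := abs_precondSlope_le (mul_pos (discount_pos hT) (hvi i))
        (by positivity : 0 < 1 / (T : ℝ)) hε (gradient f s.x i)
      have h2 : η / √T ≤ 1 := by
        rw [div_le_one (Real.sqrt_pos.2 (by linarith))]
        refine hη1.trans (Real.one_le_sqrt.2 (by linarith))
      rw [abs_mul, abs_of_nonneg (by positivity : 0 ≤ η / √T)]
      calc η / √T * _ ≤ 1 * (2 / ε) := by gcongr
        _ = _ := one_mul _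
  calc ∑ i, |noiseCoeff f v ε β₁ η T s i| ≤ ∑ _i : Fin d, slopeConst d L β₁ * (2 / ε) :=
        Finset.sum_le_sum fun i _ => this i
    _ = _ := by simp

/-- Linearization of the decrease around the exact gradient. -/
lemma neg_decrease_le
    (hf : Differentiable ℝ f) (hlip : ∀ x y, ‖gradient f x - gradient f y‖ ≤ L * ‖x - y‖)
    (hb : BddBelow (Set.range f)) (hL : 0 < L) (hv : 0 < v) (hε : 0 < ε) (hβ : 0 ≤ β₁)
    (hβ1 : β₁ < 1) (hη : 0 < η) (hη1 : η ≤ 1) (hT : 10 ≤ T)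
    (hs : Admissible v T n s) (hn : n < T) (g : EuclideanSpace ℝ (Fin d)) :
    -decrease f (horizonParams v ε β₁ η T) s g
      ≤ -exactDecrease f (horizonParams v ε β₁ η T) s
        + ⟪noiseCoeff f v ε β₁ η T s, g - gradient f s.x⟫_ℝ
        + slopeConst d L β₁ * curvConst v ε / T * ‖g - gradient f s.x‖ ^ 2 := by
  have hvi := hs.v_pos hT hv
  have hT' : (10 : ℝ) ≤ T := by exact_mod_cast hT
  have hT0 : (0 : ℝ) < T := by linarith
  have hG := norm_gradient_le_rad hf hlip hb hL hv hε hβ hβ1 hη hη1 hT hs hn.le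
  have hQ := one_le_slopeConst d hL hβ hβ1
  have hr : 1 ≤ rad f (horizonParams v ε β₁ η T) s := one_le_sqrt_fbar hb _
  set G := gradient f s.x with hGd
  unfold exactDecrease decrease
  rw [PiLp.inner_apply, EuclideanSpace.real_norm_sq_eq, Finset.mul_sum, ← hGd, Finset.sum_div,
    Finset.sum_div, ← Finset.sum_neg_distrib, ← Finset.sum_neg_distrib, ← Finset.sum_add_distrib,
    ← Finset.sum_add_distrib]
  refine Finset.sum_le_sum fun i _ => ?_
  have ha : 0 < (1 - 1 / (T : ℝ)) * s.v i := mul_pos (discount_pos hT) (hvi i)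
  -- Within the horizon the discounted second moment stays above v/9, so the curvature constant does
  -- not depend on T.
  have ha9 : v / 9 ≤ (1 - 1 / (T : ℝ)) * s.v i := by
    have h1 := one_ninth_le_discount_pow hT (Nat.succ_le_of_lt hn)
    have h2 := mul_le_mul_of_nonneg_left (hs.lower i) (discount_pos hT).le
    rw [← mul_assoc, ← pow_succ'] at h2
    have h3 := mul_le_mul_of_nonneg_right h1 hv.le
    have h4 : (1 - 1 / (T : ℝ)) ^ n.succ = (1 - 1 / (T : ℝ)) ^ (n + 1) := rfl
    rw [h4] at h3
    linarith
  have hsnd := precond_second_order ha (by positivity : 0 < 1 / (T : ℝ)) hε (g i) (G i)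
  rw [horizonParams_precond, horizonParams_precond, step_v_apply, step_v_apply]
  have hnoise : noiseCoeff f v ε β₁ η T s i = -(G i / (2 * rad f (horizonParams v ε β₁ η T) s)
    * (η / √T * precondSlope ((1 - 1 / (T : ℝ)) * s.v i) (1 / (T : ℝ)) ε (G i))) := rfl
  have hq : |G i / (2 * rad f (horizonParams v ε β₁ η T) s)| ≤ slopeConst d L β₁ := by
    rw [abs_div, abs_of_pos (by linarith : 0 < 2 * rad f (horizonParams v ε β₁ η T) s),
        div_le_iff₀ (by linarith)]
    refine (abs_apply_le_norm _ i).trans (hG.trans (le_of_eq ?_))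
    ring
  have hin : ⟪noiseCoeff f v ε β₁ η T s i, (g - G) i⟫_ℝ
      = noiseCoeff f v ε β₁ η T s i * (g i - G i) := by
    simp [mul_comm]
  rw [hin, hnoise, PiLp.sub_apply]
  set a := (1 - 1 / (T : ℝ)) * s.v i
  set R := rad f (horizonParams v ε β₁ η T) s
  set σ := precondSlope a (1 / (T : ℝ)) ε (G i)
  set A1 := (√(a + 1 / (T : ℝ) * g i ^ 2) + ε)⁻¹
  set A2 := (√(a + 1 / (T : ℝ) * G i ^ 2) + ε)⁻¹
  have hK : 2 / (ε * √a) + 2 / ε ^ 2 ≤ curvConst v ε := by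
    unfold curvConst
    have : 0 < √(v / 9) := Real.sqrt_pos.2 (by positivity)
    gcongr
  -- One factor 1/√T comes from the step size, the other from the curvature √b at b = 1/T. The
  -- quadratic error is thus O(1/T) per step.
  have hγ : η / √T * √(1 / (T : ℝ)) ≤ 1 / T := by
    rw [Real.sqrt_div zero_le_one, Real.sqrt_one, div_mul_div_comm, mul_one,
      Real.mul_self_sqrt hT0.le]
    gcongr
  have hcv : 0 ≤ curvConst v ε := by unfold curvConst; positivity
  have hmain : |G i / (2 * R) * (η / √T) * (g i * A1 - G i * A2 - σ * (g i - G i))|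
      ≤ slopeConst d L β₁ * curvConst v ε / T * (g i - G i) ^ 2 := by
    rw [abs_mul, abs_mul, abs_of_nonneg (by positivity : 0 ≤ η / √T)]
    calc |G i / (2 * R)| * (η / √T) * |g i * A1 - G i * A2 - σ * (g i - G i)|
        ≤ slopeConst d L β₁ * (η / √T)
          * (√(1 / (T : ℝ)) * curvConst v ε * (g i - G i) ^ 2) := by
          gcongr
          exact hsnd.trans (by gcongr)
      _ = slopeConst d L β₁ * (η / √T * √(1 / (T : ℝ))) * curvConst v ε * (g i - G i) ^ 2 := by
          ring
      _ ≤ slopeConst d L β₁ * (1 / T) * curvConst v ε * (g i - G i) ^ 2 := by gcongr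
      _ = _ := by ring
  have h3 := (abs_le.1 hmain).1
  have e1 : G i * (η / √T * A1 * g i) / (2 * R) = G i / (2 * R) * (η / √T) * (g i * A1) := by ring
  have e2 : G i * (η / √T * A2 * G i) / (2 * R) = G i / (2 * R) * (η / √T) * (G i * A2) := by ring
  rw [e1, e2]
  nlinarith

/-- The stochastic one-step inequality for the exponential Lyapunov function. -/
lemma exp_lyapunov_step_le_noise
    (hf : Differentiable ℝ f) (hlip : ∀ x y, ‖gradient f x - gradient f y‖ ≤ L * ‖x - y‖)
    (hb : BddBelow (Set.range f)) (hL : 0 < L) (hv : 0 < v) (hε : 0 < ε) (hβ : 0 ≤ β₁)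
    (hβ1 : β₁ < 1) (hη : 0 < η) (hη1 : η ≤ 1) (hT : 10 ≤ T)
    (hs : Admissible v T n s) (hn : n < T)
    (g : EuclideanSpace ℝ (Fin d)) :
    Real.exp (expRate d L β₁
        * lyapunov f L v ε β₁ η T (n + 1) ((horizonParams v ε β₁ η T).step s g))
      ≤ Real.exp (expRate d L β₁ * lyapunov f L v ε β₁ η T n s)
        * Real.exp (expRate d L β₁ * driftConst L β₁ * d / T)
        * (1 - expRate d L β₁ * exactDecrease f (horizonParams v ε β₁ η T) s
          + ⟪expRate d L β₁ • noiseCoeff f v ε β₁ η T s, g - gradient f s.x⟫_ℝ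
          + expRate d L β₁ * (slopeConst d L β₁ * curvConst v ε) / T
            * ‖g - gradient f s.x‖ ^ 2) := by
  refine (exp_lyapunov_step_le hf hlip hb hL hv hε hβ hβ1 hη hη1 hT hs hn.le g).trans ?_
  refine mul_le_mul_of_nonneg_left ?_ (by positivity)
  have h := mul_le_mul_of_nonneg_left
    (neg_decrease_le hf hlip hb hL hv hε hβ hβ1 hη hη1 hT hs hn g) (expRate_pos d hL hβ hβ1).le
  rw [inner_smul_left]
  simp only [conj_trivial]
  have e : expRate d L β₁ * (slopeConst d L β₁ * curvConst v ε) / T * ‖g - gradient f s.x‖ ^ 2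
    = expRate d L β₁ * (slopeConst d L β₁ * curvConst v ε / T * ‖g - gradient f s.x‖ ^ 2) := by
    ring
  rw [e]
  linarith

end Lyapunov

/-! ### Conditional expectations, one supermartingale step, the maximal inequality. -/

section Supermartingales

open MeasureTheory
open scoped InnerProductSpace

section Probability

variable {Ω : Type*} {m mΩ : MeasurableSpace Ω} {μ : Measure Ω} [IsProbabilityMeasure μ]
  {E : Type*} [NormedAddCommGroup E] [InnerProductSpace ℝ E] [CompleteSpace E]

/-- A square-integrable deviation from an adapted conditional mean has conditional mean zero. -/
lemma condExp_sub_eq_zero (hm : m ≤ mΩ) {X Y : Ω → E} (hY : StronglyMeasurable[m] Y)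
    (hXY : MemLp (fun ω => X ω - Y ω) 2 μ) (h : μ[X|m] =ᵐ[μ] Y) :
    μ[fun ω => X ω - Y ω|m] =ᵐ[μ] 0 := by
  have hi : Integrable (fun ω => X ω - Y ω) μ := hXY.integrable one_le_two
  have hX : Integrable X μ := by
    -- The conditional expectation of a non-integrable X is 0 by convention. Then Y = 0 almost
    -- everywhere, so X agrees with the integrable X - Y.
    by_contra hX
    rw [condExp_of_not_integrable hX] at h
    refine hX (hi.congr ?_)
    filter_upwards [h] with ω hω
    simp [← hω]
  have hYi : Integrable Y μ := by
    have := hX.sub hi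
    refine this.congr (Filter.Eventually.of_forall fun ω => ?_)
    simp
  have h1 := condExp_sub (m := m) hX hYi
  have h2 := condExp_of_stronglyMeasurable hm hY hYi
  have e : (fun ω => X ω - Y ω) = X - Y := rfl
  rw [e]
  filter_upwards [h1, h] with ω hω hω'
  rw [hω, h2]
  simp [hω']

lemma integral_inner_eq_zero (hm : m ≤ mΩ) {a ξ : Ω → E} {B : ℝ} (ha : StronglyMeasurable[m] a)
    (hab : ∀ ω, ‖a ω‖ ≤ B) (hξ : Integrable ξ μ) (hξ0 : μ[ξ|m] =ᵐ[μ] 0) :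
    Integrable (fun ω => ⟪a ω, ξ ω⟫_ℝ) μ ∧ ∫ ω, ⟪a ω, ξ ω⟫_ℝ ∂μ = 0 := by
  have hint : Integrable (fun ω => ⟪a ω, ξ ω⟫_ℝ) μ := by
    refine Integrable.mono' (hξ.norm.const_mul B)
      ((ha.mono hm).aestronglyMeasurable.inner hξ.aestronglyMeasurable)
      (Filter.Eventually.of_forall fun ω => ?_)
    exact (norm_inner_le_norm _ _).trans (mul_le_mul_of_nonneg_right (hab ω) (norm_nonneg _))
  refine ⟨hint, ?_⟩
  have h := condExp_bilin_of_stronglyMeasurable_left (innerSL ℝ (E := E)) ha hint hξ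
  rw [← integral_condExp hm]
  refine integral_eq_zero_of_ae ?_
  refine h.trans ?_
  filter_upwards [hξ0] with ω hω
  simp [hω]

lemma integral_mul_le_of_condExp_le (hm : m ≤ mΩ) {H Y : Ω → ℝ} {B C : ℝ}
    (hH : StronglyMeasurable[m] H) (hH0 : ∀ ω, 0 ≤ H ω) (hHB : ∀ ω, H ω ≤ B)
    (hY : Integrable Y μ) (hYC : μ[Y|m] ≤ᵐ[μ] fun _ => C) :
    Integrable (fun ω => H ω * Y ω) μ ∧ ∫ ω, H ω * Y ω ∂μ ≤ C * ∫ ω, H ω ∂μ := by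
  have hHb : ∀ᵐ ω ∂μ, ‖H ω‖ ≤ B := Filter.Eventually.of_forall fun ω => by
    rw [Real.norm_eq_abs, abs_of_nonneg (hH0 ω)]; exact hHB ω
  have hHm := (hH.mono hm).aestronglyMeasurable (μ := μ)
  have hint : Integrable (fun ω => H ω * Y ω) μ := hY.bdd_mul hHm hHb
  have hHi : Integrable H μ := Integrable.of_bound hHm B hHb
  refine ⟨hint, ?_⟩
  have h := condExp_mul_of_stronglyMeasurable_left hH hint hY
  rw [← integral_condExp hm, ← integral_const_mul]
  refine integral_mono_ae integrable_condExp (hHi.const_mul C) ?_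
  filter_upwards [h, hYC] with ω h1 h2
  have e : (fun ω => H ω * Y ω) = H * Y := rfl
  rw [e, h1, Pi.mul_apply, mul_comm]
  exact mul_le_mul_of_nonneg_right h2 (hH0 ω)

/-- One step of an exponential supermartingale driven by noise with bounded conditional
variance. -/
lemma setIntegral_step_le (hm : m ≤ mΩ) {W W' D : Ω → ℝ} {a ξ : Ω → E} {k C B B₁ B₂ : ℝ}
    (hW : StronglyMeasurable[m] W) (hW0 : ∀ ω, 0 ≤ W ω) (hWB : ∀ ω, W ω ≤ B)
    (hD : StronglyMeasurable[m] D) (hD0 : ∀ ω, 0 ≤ D ω) (hDB : ∀ ω, D ω ≤ B₁)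
    (ha : StronglyMeasurable[m] a) (haB : ∀ ω, ‖a ω‖ ≤ B₂)
    (hξ : MemLp ξ 2 μ) (hξ0 : μ[ξ|m] =ᵐ[μ] 0) (hξC : μ[fun ω => ‖ξ ω‖ ^ 2|m] ≤ᵐ[μ] fun _ => C)
    (hk : 0 ≤ k) (hW' : Integrable W' μ)
    (hstep : ∀ ω, W' ω ≤ W ω * Real.exp (D ω - k * C)
      * (1 - D ω + ⟪a ω, ξ ω⟫_ℝ + k * ‖ξ ω‖ ^ 2))
    {S : Set Ω} (hS : MeasurableSet[m] S) : ∫ ω in S, W' ω ∂μ ≤ ∫ ω in S, W ω ∂μ := by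
  have hB0 : ∀ ω : Ω, 0 ≤ B := fun ω => (hW0 ω).trans (hWB ω)
  -- The indicator of S is put into the `m`-measurable weight, so the conditional bounds apply to
  -- integrals over the whole space.
  set H : Ω → ℝ := S.indicator fun ω => W ω * Real.exp (D ω - k * C) with hHd
  have hHm : StronglyMeasurable[m] H :=
    (hW.mul (Real.continuous_exp.comp_stronglyMeasurable
      (hD.sub stronglyMeasurable_const))).indicator hS
  have hH0 : ∀ ω, 0 ≤ H ω := fun ω =>
    Set.indicator_nonneg (fun ω _ => mul_nonneg (hW0 ω) (Real.exp_pos _).le) ω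
  have hHB : ∀ ω, H ω ≤ B * Real.exp (B₁ - k * C) := fun ω => by
    refine Set.indicator_apply_le' (fun _ => ?_) (fun _ => ?_)
    · have := hDB ω
      have := hB0 ω
      have := hWB ω
      gcongr
    · exact mul_nonneg (hB0 ω) (Real.exp_pos _).le
  have hHi : Integrable H μ := Integrable.of_bound (hHm.mono hm).aestronglyMeasurable
    (B * Real.exp (B₁ - k * C)) (Filter.Eventually.of_forall fun ω => by
      rw [Real.norm_eq_abs, abs_of_nonneg (hH0 ω)]; exact hHB ω)
  have hsq : Integrable (fun ω => ‖ξ ω‖ ^ 2) μ := hξ.integrable_norm_pow two_ne_zero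
  obtain ⟨hi1, h1⟩ := integral_mul_le_of_condExp_le hm hHm hH0 hHB hsq hξC
  obtain ⟨hi2, h2⟩ := integral_inner_eq_zero (a := fun ω => H ω • a ω)
    (B := B * Real.exp (B₁ - k * C) * B₂) hm (hHm.smul ha) (fun ω => by
      rw [norm_smul, Real.norm_eq_abs, abs_of_nonneg (hH0 ω)]
      exact mul_le_mul (hHB ω) (haB ω) (norm_nonneg _) ((hH0 ω).trans (hHB ω)))
    (hξ.integrable one_le_two) hξ0
  have hi3 : Integrable (fun ω => H ω * (1 - D ω)) μ := by
    have : Integrable (fun ω => (1 - D ω) * H ω) μ := by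
      refine hHi.bdd_mul (c := 1 + B₁)
        (((stronglyMeasurable_const (α := Ω) (b := (1 : ℝ))).sub hD).mono hm).aestronglyMeasurable
        (Filter.Eventually.of_forall fun ω => ?_)
      have := hD0 ω
      have := hDB ω
      show |1 - D ω| ≤ _
      rw [abs_le]; constructor <;> linarith
    simpa [mul_comm] using this
  have hWi : Integrable W μ := Integrable.of_bound (hW.mono hm).aestronglyMeasurable B
    (Filter.Eventually.of_forall fun ω => by
      rw [Real.norm_eq_abs, abs_of_nonneg (hW0 ω)]; exact hWB ω)
  rw [← integral_indicator (hm _ hS), ← integral_indicator (hm _ hS)]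
  calc ∫ ω, S.indicator W' ω ∂μ
      ≤ ∫ ω, (H ω * (1 - D ω) + ⟪H ω • a ω, ξ ω⟫_ℝ + k * (H ω * ‖ξ ω‖ ^ 2)) ∂μ := by
        refine integral_mono (hW'.indicator (hm _ hS)) ((hi3.add hi2).add (hi1.const_mul k))
          fun ω => ?_
        by_cases hω : ω ∈ S
        · simp only [hHd, Set.indicator_of_mem hω, inner_smul_left, conj_trivial]
          refine (hstep ω).trans (le_of_eq ?_)
          ring
        · simp [hHd, Set.indicator_of_notMem hω]
    _ = ∫ ω, H ω * (1 - D ω) ∂μ + 0 + k * ∫ ω, H ω * ‖ξ ω‖ ^ 2 ∂μ := by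
        have e1 := integral_add (hi3.add hi2) (hi1.const_mul k)
        have e2 := integral_add hi3 hi2
        simp only [Pi.add_apply] at e1 e2
        rw [e1, e2, h2, integral_const_mul]
    _ ≤ ∫ ω, H ω * (1 - D ω) ∂μ + 0 + k * (C * ∫ ω, H ω ∂μ) := by gcongr
    _ = ∫ ω, (H ω * (1 - D ω) + k * C * H ω) ∂μ := by
        rw [integral_add hi3 (hHi.const_mul _), integral_const_mul]; ring
    _ ≤ ∫ ω, S.indicator W ω ∂μ := by
        refine integral_mono (hi3.add (hHi.const_mul _)) (hWi.indicator (hm _ hS)) fun ω => ?_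
        by_cases hω : ω ∈ S
        · simp only [hHd, Set.indicator_of_mem hω]
          -- Once the noise is averaged out, the factor 1 - (D - kC) remains; it is at most exp(-(D
          -- - kC)), which the compensation in the weight cancels.
          have h3 := Real.add_one_le_exp (-(D ω - k * C))
          have h4 : Real.exp (D ω - k * C) * Real.exp (-(D ω - k * C)) = 1 := by
            rw [← Real.exp_add]; simp
          calc W ω * Real.exp (D ω - k * C) * (1 - D ω)
                + k * C * (W ω * Real.exp (D ω - k * C))
              = W ω * (Real.exp (D ω - k * C) * (-(D ω - k * C) + 1)) := by ring
            _ ≤ W ω * (Real.exp (D ω - k * C) * Real.exp (-(D ω - k * C))) :=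
                mul_le_mul_of_nonneg_left
                  (mul_le_mul_of_nonneg_left h3 (Real.exp_pos _).le) (hW0 ω)
            _ = W ω := by rw [h4, mul_one]
        · simp [hHd, Set.indicator_of_notMem hω]

/-- Maximal inequality for nonnegative supermartingales on a finite horizon. -/
lemma mul_measureReal_exists_le {ℱ : ℕ → MeasurableSpace Ω} (hℱ : ∀ n, ℱ n ≤ mΩ)
    (hmono : Monotone ℱ) {W : ℕ → Ω → ℝ} {N : ℕ} (hWm : ∀ n, StronglyMeasurable[ℱ n] (W n))
    (hW0 : ∀ n ω, 0 ≤ W n ω) (hWi : ∀ n ≤ N, Integrable (W n) μ)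
    (hstep : ∀ n < N, ∀ S, MeasurableSet[ℱ n] S → ∫ ω in S, W (n + 1) ω ∂μ ≤ ∫ ω in S, W n ω ∂μ)
    (a : ℝ) : a * μ.real {ω | ∃ n ≤ N, a ≤ W n ω} ≤ ∫ ω, W 0 ω ∂μ := by
  have hmeas : ∀ n, MeasurableSet[ℱ n] {ω | ∃ k ≤ n, a ≤ W k ω} := by
    intro n
    have : {ω | ∃ k ≤ n, a ≤ W k ω} = ⋃ k ∈ Finset.range (n + 1), {ω | a ≤ W k ω} := by
      ext ω; simp
    rw [this]
    refine Finset.measurableSet_biUnion _ fun k hk => ?_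
    exact hmono (Nat.lt_succ_iff.1 (Finset.mem_range.1 hk)) _
      (measurableSet_le (mδ := ℱ k) measurable_const (hWm k).measurable)
  -- The invariant of the stopped process: paths that first reach the level at time n+1 pass from
  -- the integral to the probability term, where each counts only a.
  have key : ∀ n ≤ N, a * μ.real {ω | ∃ k ≤ n, a ≤ W k ω}
      + ∫ ω in {ω | ∃ k ≤ n, a ≤ W k ω}ᶜ, W n ω ∂μ ≤ ∫ ω, W 0 ω ∂μ := by
    intro n
    induction n with
    | zero =>
      intro h0
      have hm0 := hℱ 0 _ (hmeas 0)
      rw [← integral_add_compl hm0 (hWi 0 h0)]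
      gcongr
      refine setIntegral_ge_of_const_le_real hm0 (measure_ne_top _ _) ?_ (hWi 0 h0).integrableOn
      rintro ω ⟨k, hk, h⟩
      rwa [Nat.le_zero.1 hk] at h
    | succ n ih =>
      intro hn
      have ih' := ih (by omega)
      set A := {ω | ∃ k ≤ n, a ≤ W k ω} with hA
      set A' := {ω | ∃ k ≤ n + 1, a ≤ W k ω} with hA'
      have hmA := hℱ n _ (hmeas n)
      have hmA' := hℱ (n + 1) _ (hmeas (n + 1))
      have hsub : A ⊆ A' := fun ω ⟨k, hk, h⟩ => ⟨k, by omega, h⟩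
      have h1 := hstep n (by omega) Aᶜ (hmeas n).compl
      have hun : Aᶜ = (A' \ A) ∪ A'ᶜ := by
        ext ω
        have := @hsub ω
        simp only [Set.mem_compl_iff, Set.mem_union, Set.mem_sdiff]
        tauto
      have hdisj : Disjoint (A' \ A) A'ᶜ := by
        rw [Set.disjoint_left]; rintro ω ⟨h, -⟩ h'; exact h' h
      have h2 : ∫ ω in Aᶜ, W (n + 1) ω ∂μ
          = ∫ ω in A' \ A, W (n + 1) ω ∂μ + ∫ ω in A'ᶜ, W (n + 1) ω ∂μ := by
        rw [hun]
        exact setIntegral_union hdisj hmA'.compl (hWi _ hn).integrableOn (hWi _ hn).integrableOn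
      have h3 : a * μ.real (A' \ A) ≤ ∫ ω in A' \ A, W (n + 1) ω ∂μ := by
        refine setIntegral_ge_of_const_le_real (hmA'.diff hmA) (measure_ne_top _ _) ?_
          (hWi _ hn).integrableOn
        rintro ω ⟨⟨k, hk, h⟩, hnA⟩
        rcases Nat.lt_or_ge k (n + 1) with hk' | hk'
        · exact absurd ⟨k, by omega, h⟩ hnA
        · rwa [show k = n + 1 by omega] at h
      have h4 : μ.real A' = μ.real A + μ.real (A' \ A) := by
        rw [measureReal_sdiff hsub hmA]; ring
      rw [h4]
      linarith
  have := key N le_rfl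
  have h0 : 0 ≤ ∫ ω in {ω | ∃ k ≤ N, a ≤ W k ω}ᶜ, W N ω ∂μ :=
    setIntegral_nonneg (hℱ N _ (hmeas N)).compl fun ω _ => hW0 N ω
  linarith

end Probability

end Supermartingales

/-! ### Measurability of the Adam state with respect to the history. -/

section Adaptedness

open MeasureTheory
open scoped InnerProductSpace

variable {d : ℕ} {f : EuclideanSpace ℝ (Fin d) → ℝ} {L v ε β₁ η : ℝ} {T n : ℕ}

section Measurability

variable {Ω : Type*} {m : MeasurableSpace Ω} {s : Ω → State d}

/-- A random state whose components are measurable. -/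
structure MeasurableState (m : MeasurableSpace Ω) (s : Ω → State d) : Prop where
  x : Measurable fun ω => (s ω).x
  m : ∀ i, Measurable fun ω => (s ω).m i
  v : ∀ i, Measurable fun ω => (s ω).v i

lemma measurable_coord {X : Ω → EuclideanSpace ℝ (Fin d)} (hX : Measurable X) (i : Fin d) :
    Measurable fun ω => X ω i :=
  (EuclideanSpace.proj (𝕜 := ℝ) i).continuous.measurable.comp hX

lemma measurable_of_coord {X : Ω → EuclideanSpace ℝ (Fin d)}
    (hX : ∀ i, Measurable fun ω => X ω i) : Measurable X :=
  (WithLp.measurable_toLp 2 (Fin d → ℝ)).comp (measurable_pi_iff.2 hX)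

lemma Params.measurable_precond (p : Params) {w : Ω → Fin d → ℝ} (i : Fin d)
    (hw : Measurable fun ω => w ω i) : Measurable fun ω => p.precond (w ω) i :=
  measurable_const.mul ((hw.sqrt.add_const _).inv)

lemma MeasurableState.step (hs : MeasurableState m s) (p : Params)
    {G : Ω → EuclideanSpace ℝ (Fin d)} (hG : Measurable G) :
    MeasurableState m fun ω => p.step (s ω) (G ω) := by
  have hm : ∀ i, Measurable fun ω => (p.step (s ω) (G ω)).m i := fun i =>
    ((hs.m i).const_mul _).add ((measurable_coord hG i).const_mul _)
  have hv : ∀ i, Measurable fun ω => (p.step (s ω) (G ω)).v i := fun i =>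
    ((hs.v i).const_mul _).add
      (((measurable_coord hG i).mul (measurable_coord hG i)).const_mul _)
  exact ⟨measurable_of_coord fun i => (measurable_coord hs.x i).sub
    ((p.measurable_precond i (hv i)).mul (hm i)), hm, hv⟩

lemma MeasurableState.rad (hs : MeasurableState m s) (hf : Continuous f) (p : Params) :
    Measurable fun ω => rad f p (s ω) := by
  have h1 : Measurable fun ω => p.auxPoint (s ω) := measurable_of_coord fun i =>
    (measurable_coord hs.x i).sub
      (((p.measurable_precond i (hs.v i)).mul (hs.m i)).const_mul _)
  exact (((hf.measurable.comp h1).sub_const _).add_const _).sqrt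

lemma MeasurableState.exactDecrease (hs : MeasurableState m s) (hf : Continuous f)
    (hG : Continuous (gradient f)) (p : Params) :
    Measurable fun ω => exactDecrease f p (s ω) := by
  have h1 : Measurable fun ω => gradient f (s ω).x := hG.measurable.comp hs.x
  have h2 := hs.step p h1
  exact (Finset.measurable_sum _ fun i _ => (measurable_coord h1 i).mul
    ((p.measurable_precond i (h2.v i)).mul (measurable_coord h1 i))).div
    ((hs.rad hf p).const_mul 2)

lemma MeasurableState.lyapunov (hs : MeasurableState m s) (hf : Continuous f) :
    Measurable fun ω => lyapunov f L v ε β₁ η T n (s ω) := by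
  refine ((hs.rad hf _).sub (Measurable.const_mul (Finset.measurable_sum _ fun i _ => ?_) _)).add
    (Measurable.const_mul (Finset.measurable_sum _ fun i _ => ?_) _)
  · exact ((hs.v i).div_const _).log
  · exact (((hs.m i).pow_const 2).div ((hs.v i).const_mul _)).const_mul _

lemma MeasurableState.noiseCoeff (hs : MeasurableState m s) (hf : Continuous f)
    (hG : Continuous (gradient f)) : Measurable fun ω => noiseCoeff f v ε β₁ η T (s ω) := by
  have h1 : Measurable fun ω => gradient f (s ω).x := hG.measurable.comp hs.x
  refine measurable_of_coord fun i => ?_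
  have h2 := measurable_coord h1 i
  have h3 := hs.v i
  have h4 := hs.rad hf (horizonParams v ε β₁ η T)
  simp only [AdamEnergy.noiseCoeff, precondSlope]
  fun_prop

end Measurability

section History

variable {Ω Z : Type*} [MeasurableSpace Z]

lemma history_mono (z : ℕ → Ω → Z) : Monotone (history z) := fun a b hab =>
  biSup_mono fun s hs => by
    simp only [Finset.mem_Icc] at hs ⊢
    omega

lemma history_le {mΩ : MeasurableSpace Ω} {z : ℕ → Ω → Z} (hz : ∀ t, 1 ≤ t → Measurable (z t))
    (n : ℕ) : history z n ≤ mΩ :=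
  iSup₂_le fun s hs => (hz s (Finset.mem_Icc.1 hs).1).comap_le

lemma measurable_history (z : ℕ → Ω → Z) (n : ℕ) : Measurable[history z (n + 1)] (z (n + 1)) := by
  rw [measurable_iff_comap_le]
  exact le_iSup₂ (f := fun s (_ : s ∈ Finset.Icc 1 (n + 1)) =>
    MeasurableSpace.comap (z s) inferInstance) (n + 1) (by simp)

lemma MeasurableState.mono {m m' : MeasurableSpace Ω} {s : Ω → State d}
    (hs : MeasurableState m s) (h : m ≤ m') : MeasurableState m' s :=
  ⟨hs.x.mono h le_rfl, fun i => (hs.m i).mono h le_rfl, fun i => (hs.v i).mono h le_rfl⟩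

lemma measurableState_adam (p : Params)
    {g : EuclideanSpace ℝ (Fin d) → Z → EuclideanSpace ℝ (Fin d)}
    (hg : Measurable (Function.uncurry g)) (x₁ : EuclideanSpace ℝ (Fin d)) (z : ℕ → Ω → Z)
    (n : ℕ) : MeasurableState (history z n) fun ω => adam p g x₁ (fun k => z k ω) n := by
  induction n with
  | zero => exact ⟨measurable_const, fun i => measurable_const, fun i => measurable_const⟩
  | succ n ih =>
    have ih' := ih.mono (history_mono z n.le_succ)
    exact ih'.step p (hg.comp (ih'.x.prodMk (measurable_history z n)))

end History

end Adaptedness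

/-! ### Pathwise control of the exponential weight and of the total second moment. -/

section Trajectory

open MeasureTheory
open scoped InnerProductSpace

section Constants

variable (d : ℕ) (L C v ε β₁ F : ℝ)

/-- Total compensation of the exponential supermartingale over the horizon. -/
def compConst : ℝ :=
  expRate d L β₁ * (driftConst L β₁ * d) + expRate d L β₁ * (slopeConst d L β₁ * curvConst v ε) * C

/-- Initial value of the exponential supermartingale. -/
def initConst : ℝ :=
  Real.exp (expRate d L β₁ * (√F - logWeight d L β₁ * (d * Real.log v)))

/-- Weight of the supermartingale in the bound of the second moments. -/
def massWeight : ℝ :=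
  8 * slopeConst d L β₁ ^ 2 / expRate d L β₁ ^ 2 * Real.exp (compConst d L C v ε β₁)

/-- Expected size of the root of the total second moment. -/
def massConst : ℝ :=
  √(1 + d * v) + 9 * (massWeight d L C v ε β₁ * initConst d L v β₁ F + C)

end Constants

variable {d : ℕ} {f : EuclideanSpace ℝ (Fin d) → ℝ} {L C v ε β₁ η F : ℝ} {T n : ℕ} {s : State d}

/-- The total undiscounted second moment. -/
def mass (T n : ℕ) (s : State d) : ℝ := 1 + ∑ i, s.v i / (1 - 1 / (T : ℝ)) ^ n

variable {Ω Z : Type*} {g : EuclideanSpace ℝ (Fin d) → Z → EuclideanSpace ℝ (Fin d)}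
  {x₁ : EuclideanSpace ℝ (Fin d)}

/-- The accumulated exact decrease over the first `n` iterations. -/
def accum (f : EuclideanSpace ℝ (Fin d) → ℝ) (p : Params)
    (g : EuclideanSpace ℝ (Fin d) → Z → EuclideanSpace ℝ (Fin d)) (x₁ : EuclideanSpace ℝ (Fin d))
    (ζ : ℕ → Z) (n : ℕ) : ℝ :=
  ∑ k ∈ Finset.range n, exactDecrease f p (adam p g x₁ ζ k)

/-- The exponential supermartingale along the trajectory. -/
def expWeight (f : EuclideanSpace ℝ (Fin d) → ℝ) (L C v ε β₁ η : ℝ) (T : ℕ)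
    (g : EuclideanSpace ℝ (Fin d) → Z → EuclideanSpace ℝ (Fin d)) (x₁ : EuclideanSpace ℝ (Fin d))
    (ζ : ℕ → Z) (n : ℕ) : ℝ :=
  Real.exp (expRate d L β₁ * (lyapunov f L v ε β₁ η T n
      (adam (horizonParams v ε β₁ η T) g x₁ ζ n) + accum f (horizonParams v ε β₁ η T) g x₁ ζ n)
    - compConst d L C v ε β₁ * (n / T))

/-- The deviation of the `n + 1`-st stochastic gradient from the gradient. -/
def noise (f : EuclideanSpace ℝ (Fin d) → ℝ) (p : Params)
    (g : EuclideanSpace ℝ (Fin d) → Z → EuclideanSpace ℝ (Fin d)) (x₁ : EuclideanSpace ℝ (Fin d))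
    (ζ : ℕ → Z) (n : ℕ) : EuclideanSpace ℝ (Fin d) :=
  g (adam p g x₁ ζ n).x (ζ (n + 1)) - gradient f (adam p g x₁ ζ n).x

section Pathwise

variable {ζ : ℕ → Z}

lemma accum_nonneg
    (hb : BddBelow (Set.range f)) (hε : 0 < ε) (hη : 0 < η)
    (n : ℕ) : 0 ≤ accum f (horizonParams v ε β₁ η T) g x₁ ζ n :=
  Finset.sum_nonneg fun _ _ => exactDecrease_nonneg hb hε hη

lemma curvConst_nonneg (hε : 0 < ε) : 0 ≤ curvConst v ε := by
  unfold curvConst; positivity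

lemma compConst_nonneg
    (hL : 0 < L) (hC : 0 ≤ C) (hε : 0 < ε) (hβ : 0 ≤ β₁) (hβ1 : β₁ < 1)
    : 0 ≤ compConst d L C v ε β₁ := by
  have h1 := expRate_pos d hL hβ hβ1
  have h2 := driftConst_pos hL hβ hβ1
  have h3 := one_le_slopeConst d hL hβ hβ1
  have h4 := curvConst_nonneg (v := v) hε
  unfold compConst
  positivity

lemma one_le_mass
    (hv : 0 < v) (hT : 10 ≤ T)
    (hs : Admissible v T n s) : 1 ≤ mass T n s := by
  have : 0 ≤ ∑ i, s.v i / (1 - 1 / (T : ℝ)) ^ n := Finset.sum_nonneg fun i _ =>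
    div_nonneg (hs.v_pos hT hv i).le (pow_pos (discount_pos hT) n).le
  unfold mass; linarith

/-- The supermartingale controls the potential and the accumulated decrease. -/
lemma rate_mul_le_log_expWeight
    (hL : 0 < L) (hC : 0 ≤ C) (hv : 0 < v) (hε : 0 < ε) (hβ : 0 ≤ β₁) (hβ1 : β₁ < 1) (hT : 10 ≤ T)
    (hn : n ≤ T) :
    expRate d L β₁ * (rad f (horizonParams v ε β₁ η T) (adam (horizonParams v ε β₁ η T) g x₁ ζ n)
        + accum f (horizonParams v ε β₁ η T) g x₁ ζ n)
      ≤ Real.log (expWeight f L C v ε β₁ η T g x₁ ζ n) + compConst d L C v ε β₁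
        + Real.log (√(mass T n (adam (horizonParams v ε β₁ η T) g x₁ ζ n))) := by
  have hT' : (10 : ℝ) ≤ T := by exact_mod_cast hT
  have hn' : (n : ℝ) ≤ T := by exact_mod_cast hn
  have hs := admissible_adam (ε := ε) (η := η) hT hv hβ hβ1 g x₁ ζ n
  have hκ := compConst_nonneg (d := d) (v := v) hL hC hε hβ hβ1
  have hl := expRate_pos d hL hβ hβ1
  have hA := driftConst_pos hL hβ hβ1
  have hW := logWeight_pos d hL hβ hβ1
  obtain ⟨-, -, hl3⟩ := expRate_bounds d hL hβ hβ1
  unfold expWeight lyapunov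
  set s := adam (horizonParams v ε β₁ η T) g x₁ ζ n
  have hvi := hs.v_pos hT hv
  have hmass := one_le_mass hv hT hs
  have hρn := pow_pos (discount_pos hT) n
  rw [Real.log_exp, Real.log_sqrt (by linarith)]
  have hu : 0 ≤ ∑ i, momentumRatio T n (s.m i) (s.v i) :=
    Finset.sum_nonneg fun i _ => momentumRatio_nonneg hT (hvi i) _ _
  have hlog : ∑ i, Real.log (s.v i / (1 - 1 / (T : ℝ)) ^ n) ≤ d * Real.log (mass T n s) := by
    calc ∑ i, Real.log (s.v i / (1 - 1 / (T : ℝ)) ^ n)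
        ≤ ∑ _i : Fin d, Real.log (mass T n s) := by
          refine Finset.sum_le_sum fun i _ => Real.log_le_log (div_pos (hvi i) hρn) ?_
          have := Finset.single_le_sum (f := fun i => s.v i / (1 - 1 / (T : ℝ)) ^ n)
            (fun i _ => (div_pos (hvi i) hρn).le) (Finset.mem_univ i)
          unfold mass
          linarith
      _ = _ := by simp
  have hlm := Real.log_nonneg hmass
  have h1 : expRate d L β₁ * (logWeight d L β₁ * ∑ i, Real.log (s.v i / (1 - 1 / (T : ℝ)) ^ n))
      ≤ Real.log (mass T n s) / 2 := by
    calc _ ≤ expRate d L β₁ * (logWeight d L β₁ * (d * Real.log (mass T n s))) := by gcongr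
      _ = expRate d L β₁ * (logWeight d L β₁ * d) * Real.log (mass T n s) := by ring
      _ ≤ 1 / 2 * Real.log (mass T n s) := by gcongr
      _ = _ := by ring
  have h2 : compConst d L C v ε β₁ * (n / T) ≤ compConst d L C v ε β₁ := by
    apply mul_le_of_le_one_right hκ
    rw [div_le_one (by linarith)]
    exact hn'
  have h1β : 0 < 1 - β₁ := by linarith
  have h3 : 0 ≤ expRate d L β₁ * (driftConst L β₁ / (1 - β₁)
      * ∑ i, momentumRatio T n (s.m i) (s.v i)) := by positivity
  rw [mul_add, mul_add, mul_add, mul_sub]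
  linarith

lemma expWeight_zero (hF : fbar f x₁ = F) :
    expWeight f L C v ε β₁ η T g x₁ ζ 0 = initConst d L v β₁ F := by
  have hrad : rad f (horizonParams v ε β₁ η T)
      (adam (horizonParams v ε β₁ η T) g x₁ ζ 0) = √F := by
    have haux : (horizonParams v ε β₁ η T).auxPoint
        (adam (horizonParams v ε β₁ η T) g x₁ ζ 0) = x₁ := by
      ext i; simp [Params.auxPoint, adam]
    rw [rad, haux, hF]
  rw [expWeight, lyapunov, hrad]
  simp [initConst, accum, adam, momentumRatio, horizonParams]

/-- One step of the root of the total second moment. -/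
lemma sqrt_mass_step_le
    (hf : Differentiable ℝ f) (hlip : ∀ x y, ‖gradient f x - gradient f y‖ ≤ L * ‖x - y‖)
    (hb : BddBelow (Set.range f)) (hL : 0 < L) (hC : 0 ≤ C) (hv : 0 < v) (hε : 0 < ε)
    (hβ : 0 ≤ β₁) (hβ1 : β₁ < 1) (hη : 0 < η) (hη1 : η ≤ 1) (hT : 10 ≤ T)
    (hn : n < T) :
    √(mass T (n + 1) (adam (horizonParams v ε β₁ η T) g x₁ ζ (n + 1)))
      ≤ √(mass T n (adam (horizonParams v ε β₁ η T) g x₁ ζ n))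
        + 9 / T * (massWeight d L C v ε β₁ * expWeight f L C v ε β₁ η T g x₁ ζ n
          + ‖noise f (horizonParams v ε β₁ η T) g x₁ ζ n‖ ^ 2) := by
  have hT' : (10 : ℝ) ≤ T := by exact_mod_cast hT
  have hT0 : (0 : ℝ) < T := by linarith
  have hs := admissible_adam (ε := ε) (η := η) hT hv hβ hβ1 g x₁ ζ n
  have hs1 := admissible_adam (ε := ε) (η := η) hT hv hβ hβ1 g x₁ ζ (n + 1)
  have hl := expRate_pos d hL hβ hβ1
  have hQ := one_le_slopeConst d hL hβ hβ1
  have hctrl := rate_mul_le_log_expWeight (g := g) (x₁ := x₁) (ζ := ζ)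
    (f := f) (η := η) hL hC hv hε hβ hβ1 hT hn.le
  have hacc := accum_nonneg (v := v) (β₁ := β₁) (T := T) (g := g) (x₁ := x₁) (ζ := ζ) hb hε hη n
  have hG := norm_gradient_le_rad hf hlip hb hL hv hε hβ hβ1 hη hη1 hT hs hn.le
  set p := horizonParams v ε β₁ η T with hp
  set s := adam p g x₁ ζ n with hsd
  have hr : 1 ≤ rad f p s := one_le_sqrt_fbar hb _
  set gt := g s.x (ζ (n + 1)) with hgt
  have hadam : adam p g x₁ ζ (n + 1) = p.step s gt := rfl
  rw [hadam] at hs1 ⊢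
  have hξ : noise f p g x₁ ζ n = gt - gradient f s.x := rfl
  rw [hξ]
  set W := expWeight f L C v ε β₁ η T g x₁ ζ n with hW
  have hW0 : 0 < W := Real.exp_pos _
  have hm0 := one_le_mass hv hT hs
  have hm1 := one_le_mass hv hT hs1
  have hsq0 : 1 ≤ √(mass T n s) := Real.one_le_sqrt.2 hm0
  have e0 := Real.sq_sqrt (by linarith : 0 ≤ mass T n s)
  have e1 := Real.sq_sqrt (by linarith : 0 ≤ mass T (n + 1) (p.step s gt))
  have hinc : mass T (n + 1) (p.step s gt) - mass T n s ≤ 9 / T * ‖gt‖ ^ 2 := by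
    unfold mass
    rw [EuclideanSpace.real_norm_sq_eq, add_sub_add_left_eq_sub, ← Finset.sum_sub_distrib,
      Finset.mul_sum]
    refine Finset.sum_le_sum fun i _ => ?_
    have hw : (p.step s gt).v i = (1 - 1 / (T : ℝ)) * s.v i + 1 / (T : ℝ) * gt i ^ 2 :=
      step_v_apply gt i
    have h9 := one_ninth_le_discount_pow hT (Nat.succ_le_of_lt hn)
    have hρ := discount_pos hT
    rw [hw, show n.succ = n + 1 from rfl] at *
    have e : ((1 - 1 / (T : ℝ)) * s.v i + 1 / (T : ℝ) * gt i ^ 2) / (1 - 1 / (T : ℝ)) ^ (n + 1)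
        - s.v i / (1 - 1 / (T : ℝ)) ^ n
        = 1 / (T : ℝ) * gt i ^ 2 * ((1 - 1 / (T : ℝ)) ^ (n + 1))⁻¹ := by
      rw [pow_succ]
      set ρ := 1 - 1 / (T : ℝ)
      field_simp
      ring
    rw [e]
    calc 1 / (T : ℝ) * gt i ^ 2 * ((1 - 1 / (T : ℝ)) ^ (n + 1))⁻¹
        ≤ 1 / (T : ℝ) * gt i ^ 2 * (1 / 9 : ℝ)⁻¹ := by gcongr
      _ = _ := by ring
  have hgn : ‖gt‖ ^ 2 ≤ 8 * slopeConst d L β₁ ^ 2 * rad f p s ^ 2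
      + 2 * ‖gt - gradient f s.x‖ ^ 2 := by
    have h1 : ‖gt‖ ≤ ‖gradient f s.x‖ + ‖gt - gradient f s.x‖ := by
      have := norm_add_le (gradient f s.x) (gt - gradient f s.x)
      rwa [add_sub_cancel] at this
    have h2 : ‖gt‖ ^ 2 ≤ (‖gradient f s.x‖ + ‖gt - gradient f s.x‖) ^ 2 := by gcongr
    have h3 : ‖gradient f s.x‖ ^ 2 ≤ (2 * slopeConst d L β₁ * rad f p s) ^ 2 := by gcongr
    nlinarith [sq_nonneg (‖gradient f s.x‖ - ‖gt - gradient f s.x‖)]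
  have hexp : Real.exp (expRate d L β₁ * rad f p s)
      ≤ W * Real.exp (compConst d L C v ε β₁) * √(mass T n s) := by
    rw [← Real.exp_log hW0, ← Real.exp_log (by linarith : 0 < √(mass T n s)), ← Real.exp_add,
      ← Real.exp_add]
    apply Real.exp_le_exp.2
    refine le_trans ?_ hctrl
    gcongr
    linarith
  -- From x² ≤ 2eˣ for x ≥ 0. Only the first power of √`mass` appears on the right; it cancels
  -- against 2a(b-a) ≤ b² - a² below, so the recursion for √`mass` is additive.
  have hrad : rad f p s ^ 2 ≤ 2 / expRate d L β₁ ^ 2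
      * (W * Real.exp (compConst d L C v ε β₁) * √(mass T n s)) := by
    refine le_trans ?_ (mul_le_mul_of_nonneg_left hexp (by positivity))
    have h := Real.quadratic_le_exp_of_nonneg (by positivity : 0 ≤ expRate d L β₁ * rad f p s)
    have h0 : 0 ≤ expRate d L β₁ * rad f p s := by positivity
    rw [div_mul_eq_mul_div, le_div_iff₀ (by positivity)]
    nlinarith
  have hsum : mass T (n + 1) (p.step s gt) - mass T n s
      ≤ 2 * √(mass T n s) * (9 / T * (massWeight d L C v ε β₁ * W
        + ‖gt - gradient f s.x‖ ^ 2)) := by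
    refine hinc.trans ?_
    have h1 : ‖gt‖ ^ 2 ≤ 2 * √(mass T n s) * (massWeight d L C v ε β₁ * W
        + ‖gt - gradient f s.x‖ ^ 2) := by
      refine hgn.trans ?_
      have h2 : 8 * slopeConst d L β₁ ^ 2 * rad f p s ^ 2
          ≤ 8 * slopeConst d L β₁ ^ 2 * (2 / expRate d L β₁ ^ 2
            * (W * Real.exp (compConst d L C v ε β₁) * √(mass T n s))) := by gcongr
      have h3 : 8 * slopeConst d L β₁ ^ 2 * (2 / expRate d L β₁ ^ 2
            * (W * Real.exp (compConst d L C v ε β₁) * √(mass T n s)))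
          = 2 * √(mass T n s) * (massWeight d L C v ε β₁ * W) := by
        unfold massWeight; ring
      rw [h3] at h2
      have h4 : ‖gt - gradient f s.x‖ ^ 2 ≤ √(mass T n s) * ‖gt - gradient f s.x‖ ^ 2 :=
        le_mul_of_one_le_left (by positivity) hsq0
      linarith
    calc 9 / T * ‖gt‖ ^ 2 ≤ 9 / T * (2 * √(mass T n s) * (massWeight d L C v ε β₁ * W
        + ‖gt - gradient f s.x‖ ^ 2)) := by gcongr
      _ = _ := by ring
  set a := √(mass T n s)
  set b := √(mass T (n + 1) (p.step s gt))
  have key : 2 * a * (b - a) ≤ 2 * a * (9 / T * (massWeight d L C v ε β₁ * W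
      + ‖gt - gradient f s.x‖ ^ 2)) := by
    refine le_trans ?_ hsum
    rw [← e0, ← e1]
    nlinarith [sq_nonneg (b - a)]
  have := le_of_mul_le_mul_left key (by linarith)
  linarith

lemma massWeight_nonneg : 0 ≤ massWeight d L C v ε β₁ := by
  unfold massWeight; positivity

/-- The sum of nonnegative terms is extended to the whole horizon, so that a single random variable
bounds all times and Markov's inequality is needed once. -/
lemma sqrt_mass_le
    (hf : Differentiable ℝ f) (hlip : ∀ x y, ‖gradient f x - gradient f y‖ ≤ L * ‖x - y‖)
    (hb : BddBelow (Set.range f)) (hL : 0 < L) (hC : 0 ≤ C) (hv : 0 < v) (hε : 0 < ε)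
    (hβ : 0 ≤ β₁) (hβ1 : β₁ < 1) (hη : 0 < η) (hη1 : η ≤ 1) (hT : 10 ≤ T)
    (hn : n ≤ T) :
    √(mass T n (adam (horizonParams v ε β₁ η T) g x₁ ζ n))
      ≤ √(1 + d * v) + 9 / T * ∑ k ∈ Finset.range T,
          (massWeight d L C v ε β₁ * expWeight f L C v ε β₁ η T g x₁ ζ k
            + ‖noise f (horizonParams v ε β₁ η T) g x₁ ζ k‖ ^ 2) := by
  have hpart : ∀ n ≤ T, √(mass T n (adam (horizonParams v ε β₁ η T) g x₁ ζ n))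
      ≤ √(1 + d * v) + 9 / T * ∑ k ∈ Finset.range n,
          (massWeight d L C v ε β₁ * expWeight f L C v ε β₁ η T g x₁ ζ k
            + ‖noise f (horizonParams v ε β₁ η T) g x₁ ζ k‖ ^ 2) := by
    intro n
    induction n with
    | zero =>
      intro _
      simp [mass, adam, horizonParams]
    | succ n ih =>
      intro hn
      have h := sqrt_mass_step_le (g := g) (x₁ := x₁) (ζ := ζ)
        hf hlip hb hL hC hv hε hβ hβ1 hη hη1 hT (Nat.lt_of_succ_le hn)
      rw [Finset.sum_range_succ, mul_add]
      linarith [ih (by omega)]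
  refine (hpart n hn).trans ?_
  have hm := massWeight_nonneg (d := d) (L := L) (C := C) (v := v) (ε := ε) (β₁ := β₁)
  gcongr
  · intro k _ _
    have : 0 < expWeight f L C v ε β₁ η T g x₁ ζ k := Real.exp_pos _
    positivity

/-- Every value of the supermartingale is bounded by a deterministic constant. -/
lemma exists_expWeight_le
    (hf : Differentiable ℝ f) (hlip : ∀ x y, ‖gradient f x - gradient f y‖ ≤ L * ‖x - y‖)
    (hb : BddBelow (Set.range f)) (hL : 0 < L) (hC : 0 ≤ C) (hv : 0 < v) (hε : 0 < ε)
    (hβ : 0 ≤ β₁) (hβ1 : β₁ < 1) (hη : 0 < η) (hη1 : η ≤ 1) (hT : 10 ≤ T)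
    (hF : fbar f x₁ = F) (hn : n ≤ T) :
    ∃ B, ∀ ζ : ℕ → Z, expWeight f L C v ε β₁ η T g x₁ ζ n ≤ B := by
  have hl := expRate_pos d hL hβ hβ1
  have hκ := compConst_nonneg (d := d) (v := v) hL hC hε hβ hβ1
  induction n with
  | zero =>
    exact ⟨initConst d L v β₁ F, fun ζ => (expWeight_zero hF).le⟩
  | succ n ih =>
    obtain ⟨B, hB⟩ := ih (by omega)
    -- The factors bound the drift, the new exact decrease, and 1 - lX ≤ 3/2. The bound may grow
    -- with `n`: it serves only integrability.
    refine ⟨B * (Real.exp (expRate d L β₁ * driftConst L β₁ * d / T)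
      * Real.exp (expRate d L β₁ * (slopeConst d L β₁ * √d)) * (3 / 2)), fun ζ => ?_⟩
    have hs := admissible_adam (ε := ε) (η := η) hT hv hβ hβ1 g x₁ ζ n
    refine le_trans ?_ (mul_le_mul_of_nonneg_right (hB ζ) (by positivity))
    have hstep := exp_lyapunov_step_le hf hlip hb hL hv hε hβ hβ1 hη hη1 hT hs (by omega)
      (g (adam (horizonParams v ε β₁ η T) g x₁ ζ n).x (ζ (n + 1)))
    have hX := (abs_decrease_le hf hlip hb hL hv hε hβ hβ1 hη hη1 hT hs (by omega)
      (g (adam (horizonParams v ε β₁ η T) g x₁ ζ n).x (ζ (n + 1)))).1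
    have hD := (abs_decrease_le hf hlip hb hL hv hε hβ hβ1 hη hη1 hT hs (by omega)
      (gradient f (adam (horizonParams v ε β₁ η T) g x₁ ζ n).x)).1
    obtain ⟨-, hl2, -⟩ := expRate_bounds d hL hβ hβ1
    unfold expWeight
    rw [accum, Finset.sum_range_succ, ← accum]
    change Real.exp (expRate d L β₁ * (lyapunov f L v ε β₁ η T (n + 1)
      ((horizonParams v ε β₁ η T).step _ _) + _) - _) ≤ _
    set p := horizonParams v ε β₁ η T
    set s := adam p g x₁ ζ n
    set gt := g s.x (ζ (n + 1))
    set l := expRate d L β₁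
    set ac := accum f p g x₁ ζ n
    set κ := compConst d L C v ε β₁
    set Dn := exactDecrease f p s with hDn
    have h1 : l * (lyapunov f L v ε β₁ η T (n + 1) (p.step s gt) + (ac + Dn))
        - κ * ((n + 1 : ℕ) / T) ≤ l * lyapunov f L v ε β₁ η T (n + 1) (p.step s gt)
          + (l * ac - κ * (n / T)) + l * (slopeConst d L β₁ * √d) := by
      have : l * Dn ≤ l * (slopeConst d L β₁ * √d) :=
        mul_le_mul_of_nonneg_left ((le_abs_self _).trans hD) hl.le
      have h2 : κ * ((n : ℝ) / T) ≤ κ * ((n + 1 : ℕ) / T) := by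
        push_cast
        gcongr
        linarith
      nlinarith
    refine (Real.exp_le_exp.2 h1).trans ?_
    rw [Real.exp_add, Real.exp_add]
    have h3 : 1 - l * decrease f p s gt ≤ 3 / 2 := by
      have := mul_le_mul_of_nonneg_left hX hl.le
      have h4 : -(l * |decrease f p s gt|) ≤ l * decrease f p s gt := by
        rw [← mul_neg]
        exact mul_le_mul_of_nonneg_left (neg_abs_le _) hl.le
      linarith
    calc Real.exp (l * lyapunov f L v ε β₁ η T (n + 1) (p.step s gt))
          * Real.exp (l * ac - κ * (n / T)) * Real.exp (l * (slopeConst d L β₁ * √d))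
        ≤ (Real.exp (l * lyapunov f L v ε β₁ η T n s) * Real.exp (l * driftConst L β₁ * d / T)
          * (3 / 2)) * Real.exp (l * ac - κ * (n / T))
          * Real.exp (l * (slopeConst d L β₁ * √d)) := by
          gcongr
          exact hstep.trans (mul_le_mul_of_nonneg_left h3 (by positivity))
      _ = Real.exp (l * (lyapunov f L v ε β₁ η T n s + ac) - κ * (n / T))
          * (Real.exp (l * driftConst L β₁ * d / T)
          * Real.exp (l * (slopeConst d L β₁ * √d)) * (3 / 2)) := by
          rw [show l * (lyapunov f L v ε β₁ η T n s + ac) - κ * (n / T)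
            = l * lyapunov f L v ε β₁ η T n s + (l * ac - κ * (n / T)) by ring, Real.exp_add]
          ring

/-- This is the shape `setIntegral_step_le` expects. The drift part of `compConst` cancels
exp(lAd/T), with A = `driftConst`; the variance part stays as the compensation kC. -/
lemma expWeight_step_le
    (hf : Differentiable ℝ f) (hlip : ∀ x y, ‖gradient f x - gradient f y‖ ≤ L * ‖x - y‖)
    (hb : BddBelow (Set.range f)) (hL : 0 < L) (hv : 0 < v) (hε : 0 < ε) (hβ : 0 ≤ β₁)
    (hβ1 : β₁ < 1) (hη : 0 < η) (hη1 : η ≤ 1) (hT : 10 ≤ T)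
    (hn : n < T) :
    expWeight f L C v ε β₁ η T g x₁ ζ (n + 1)
      ≤ expWeight f L C v ε β₁ η T g x₁ ζ n
        * Real.exp (expRate d L β₁ * exactDecrease f (horizonParams v ε β₁ η T)
            (adam (horizonParams v ε β₁ η T) g x₁ ζ n)
          - expRate d L β₁ * (slopeConst d L β₁ * curvConst v ε) / T * C)
        * (1 - expRate d L β₁ * exactDecrease f (horizonParams v ε β₁ η T)
            (adam (horizonParams v ε β₁ η T) g x₁ ζ n)
          + ⟪expRate d L β₁ • noiseCoeff f v ε β₁ η T (adam (horizonParams v ε β₁ η T) g x₁ ζ n),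
              noise f (horizonParams v ε β₁ η T) g x₁ ζ n⟫_ℝ
          + expRate d L β₁ * (slopeConst d L β₁ * curvConst v ε) / T
            * ‖noise f (horizonParams v ε β₁ η T) g x₁ ζ n‖ ^ 2) := by
  have hT' : (10 : ℝ) ≤ T := by exact_mod_cast hT
  have hs := admissible_adam (ε := ε) (η := η) hT hv hβ hβ1 g x₁ ζ n
  have hstep := exp_lyapunov_step_le_noise hf hlip hb hL hv hε hβ hβ1 hη hη1 hT hs hn
      (g (adam (horizonParams v ε β₁ η T) g x₁ ζ n).x (ζ (n + 1)))
  unfold expWeight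
  rw [accum, Finset.sum_range_succ, ← accum]
  change Real.exp (expRate d L β₁ * (lyapunov f L v ε β₁ η T (n + 1)
    ((horizonParams v ε β₁ η T).step _ _) + _) - _) ≤ _
  unfold noise
  set p := horizonParams v ε β₁ η T
  set s := adam p g x₁ ζ n
  set gt := g s.x (ζ (n + 1))
  set l := expRate d L β₁
  set ac := accum f p g x₁ ζ n
  set Dn := exactDecrease f p s with hDn
  set E := Real.exp (l * lyapunov f L v ε β₁ η T (n + 1) (p.step s gt)) with hE
  set N := (1 - l * Dn + ⟪l • noiseCoeff f v ε β₁ η T s, gt - gradient f s.x⟫_ℝ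
    + l * (slopeConst d L β₁ * curvConst v ε) / T * ‖gt - gradient f s.x‖ ^ 2)
  have hκ : compConst d L C v ε β₁
    = l * (driftConst L β₁ * d) + l * (slopeConst d L β₁ * curvConst v ε) * C := rfl
  have h1 : Real.exp (l * (lyapunov f L v ε β₁ η T (n + 1) (p.step s gt) + (ac + Dn))
      - compConst d L C v ε β₁ * ((n + 1 : ℕ) / T))
      = E * Real.exp (l * (ac + Dn) - compConst d L C v ε β₁ * ((n + 1 : ℕ) / T)) := by
    rw [hE, ← Real.exp_add]; congr 1; ring
  rw [h1]
  refine (mul_le_mul_of_nonneg_right hstep (Real.exp_pos _).le).trans (le_of_eq ?_)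
  have h2 : Real.exp (l * lyapunov f L v ε β₁ η T n s) * Real.exp (l * driftConst L β₁ * d / T)
      * Real.exp (l * (ac + Dn) - compConst d L C v ε β₁ * ((n + 1 : ℕ) / T))
      = Real.exp (l * (lyapunov f L v ε β₁ η T n s + ac) - compConst d L C v ε β₁ * (n / T))
        * Real.exp (l * Dn - l * (slopeConst d L β₁ * curvConst v ε) / T * C) := by
    rw [← Real.exp_add, ← Real.exp_add, ← Real.exp_add, hκ]
    congr 1
    push_cast
    field_simp
    ring
  rw [← h2]
  ring

end Pathwise

end Trajectory

/-! ### Expectations and tail bounds along the stochastic trajectory. -/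

section Expectations

open MeasureTheory
open scoped InnerProductSpace

variable {d : ℕ} {f : EuclideanSpace ℝ (Fin d) → ℝ} {L C v ε β₁ η F : ℝ} {T n : ℕ}
  {Ω Z : Type*} {mΩ : MeasurableSpace Ω} [MeasurableSpace Z] {μ : Measure Ω}
  [IsProbabilityMeasure μ] {g : EuclideanSpace ℝ (Fin d) → Z → EuclideanSpace ℝ (Fin d)}
  {x₁ : EuclideanSpace ℝ (Fin d)} {z : ℕ → Ω → Z}

lemma continuous_gradient (hlip : ∀ x y, ‖gradient f x - gradient f y‖ ≤ L * ‖x - y‖)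
    (hL : 0 < L) : Continuous (gradient f) := by
  have : LipschitzWith ⟨L, hL.le⟩ (gradient f) :=
    LipschitzWith.of_dist_le_mul fun x y => by
      rw [dist_eq_norm, dist_eq_norm]; exact hlip x y
  exact this.continuous

lemma noise_condExp (hG : Continuous (gradient f)) (hg : Measurable (Function.uncurry g))
    (hz : ∀ t, 1 ≤ t → Measurable (z t)) {p : Params} (hBV : BoundedVariance μ f p g x₁ z T C)
    (hn : n < T) :
    MemLp (fun ω => noise f p g x₁ (fun k => z k ω) n) 2 μ ∧
      μ[fun ω => noise f p g x₁ (fun k => z k ω) n|history z n] =ᵐ[μ] 0 ∧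
      μ[fun ω => ‖noise f p g x₁ (fun k => z k ω) n‖ ^ 2|history z n] ≤ᵐ[μ] fun _ => C := by
  obtain ⟨h1, h2, h3⟩ := hBV (n + 1) (by omega) (by omega)
  refine ⟨h1, ?_, h3⟩
  refine condExp_sub_eq_zero (history_le hz n) ?_ h1 h2
  exact (hG.measurable.comp (measurableState_adam p hg x₁ z n).x).stronglyMeasurable

lemma stronglyMeasurable_expWeight
    (hf : Differentiable ℝ f) (hlip : ∀ x y, ‖gradient f x - gradient f y‖ ≤ L * ‖x - y‖)
    (hL : 0 < L) (hg : Measurable (Function.uncurry g))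
    (n : ℕ) :
    StronglyMeasurable[history z n]
      fun ω => expWeight f L C v ε β₁ η T g x₁ (fun k => z k ω) n := by
  have hG := continuous_gradient hlip hL
  have hs := fun k => measurableState_adam (horizonParams v ε β₁ η T) hg x₁ z k
  have hacc : Measurable[history z n]
      fun ω => accum f (horizonParams v ε β₁ η T) g x₁ (fun k => z k ω) n := by
    refine Finset.measurable_sum _ fun k hk => ?_
    exact ((hs k).mono (history_mono z (Finset.mem_range.1 hk).le)).exactDecrease
      hf.continuous hG _
  exact ((((((hs n).lyapunov hf.continuous).add hacc).const_mul _).sub_const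
    _).exp).stronglyMeasurable

lemma integrable_expWeight
    (hf : Differentiable ℝ f) (hlip : ∀ x y, ‖gradient f x - gradient f y‖ ≤ L * ‖x - y‖)
    (hb : BddBelow (Set.range f)) (hL : 0 < L) (hC : 0 ≤ C) (hv : 0 < v) (hε : 0 < ε)
    (hβ : 0 ≤ β₁) (hβ1 : β₁ < 1) (hη : 0 < η) (hη1 : η ≤ 1) (hT : 10 ≤ T)
    (hg : Measurable (Function.uncurry g)) (hz : ∀ t, 1 ≤ t → Measurable (z t))
    (hF : fbar f x₁ = F)
    (hn : n ≤ T) :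
    Integrable (fun ω => expWeight f L C v ε β₁ η T g x₁ (fun k => z k ω) n) μ := by
  obtain ⟨B, hB⟩ := exists_expWeight_le (g := g) hf hlip hb hL hC hv hε hβ hβ1 hη hη1 hT hF hn
  refine Integrable.of_bound ((stronglyMeasurable_expWeight hf hlip hL hg n).mono
    (history_le hz n)).aestronglyMeasurable B (Filter.Eventually.of_forall fun ω => ?_)
  exact (abs_of_pos (Real.exp_pos _)).trans_le (hB _)

lemma setIntegral_expWeight_succ_le
    (hf : Differentiable ℝ f) (hlip : ∀ x y, ‖gradient f x - gradient f y‖ ≤ L * ‖x - y‖)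
    (hb : BddBelow (Set.range f)) (hL : 0 < L) (hC : 0 ≤ C) (hv : 0 < v) (hε : 0 < ε)
    (hβ : 0 ≤ β₁) (hβ1 : β₁ < 1) (hη : 0 < η) (hη1 : η ≤ 1) (hT : 10 ≤ T)
    (hg : Measurable (Function.uncurry g)) (hz : ∀ t, 1 ≤ t → Measurable (z t))
    (hF : fbar f x₁ = F) (hBV : BoundedVariance μ f (horizonParams v ε β₁ η T) g x₁ z T C)
    (hn : n < T) {S : Set Ω} (hS : MeasurableSet[history z n] S) :
    ∫ ω in S, expWeight f L C v ε β₁ η T g x₁ (fun k => z k ω) (n + 1) ∂μ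
      ≤ ∫ ω in S, expWeight f L C v ε β₁ η T g x₁ (fun k => z k ω) n ∂μ := by
  have hG := continuous_gradient hlip hL
  have hs := measurableState_adam (horizonParams v ε β₁ η T) hg x₁ z n
  obtain ⟨B, hB⟩ := exists_expWeight_le (g := g) hf hlip hb hL hC hv hε hβ hβ1 hη hη1 hT hF hn.le
  obtain ⟨hξ, hξ0, hξC⟩ := noise_condExp hG hg hz hBV hn
  have hl := expRate_pos d hL hβ hβ1
  have hQ := one_le_slopeConst d hL hβ hβ1
  have hK := curvConst_nonneg (v := v) hε
  have hadm := fun ω => admissible_adam (ε := ε) (η := η) hT hv hβ hβ1 g x₁ (fun k => z k ω) n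
  refine setIntegral_step_le (history_le hz n) (B := B)
    (B₁ := expRate d L β₁ * (slopeConst d L β₁ * √d))
    (B₂ := expRate d L β₁ * (d * (slopeConst d L β₁ * (2 / ε))))
    (stronglyMeasurable_expWeight hf hlip hL hg n) (fun ω => (Real.exp_pos _).le) (fun ω => hB _)
    ((hs.exactDecrease hf.continuous hG _).const_mul _).stronglyMeasurable
    (fun ω => mul_nonneg hl.le (exactDecrease_nonneg hb hε hη)) (fun ω => ?_)
    ((hs.noiseCoeff hf.continuous hG).const_smul (expRate d L β₁)).stronglyMeasurable
    (fun ω => ?_) hξ hξ0 hξC (k := expRate d L β₁ * (slopeConst d L β₁ * curvConst v ε) / T)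
    (by positivity)
    (integrable_expWeight hf hlip hb hL hC hv hε hβ hβ1 hη hη1 hT hg hz hF hn)
    (fun ω => expWeight_step_le hf hlip hb hL hv hε hβ hβ1 hη hη1 hT hn) hS
  · exact mul_le_mul_of_nonneg_left ((le_abs_self _).trans (abs_decrease_le hf hlip hb hL hv hε
      hβ hβ1 hη hη1 hT (hadm ω) hn.le _).1) hl.le
  · simp only [Pi.smul_apply]
    rw [norm_smul, Real.norm_eq_abs, abs_of_pos hl]
    exact mul_le_mul_of_nonneg_left (norm_noiseCoeff_le hf hlip hb hL hv hε hβ hβ1 hη hη1 hT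
      (hadm ω) hn.le) hl.le

lemma integral_expWeight_le
    (hf : Differentiable ℝ f) (hlip : ∀ x y, ‖gradient f x - gradient f y‖ ≤ L * ‖x - y‖)
    (hb : BddBelow (Set.range f)) (hL : 0 < L) (hC : 0 ≤ C) (hv : 0 < v) (hε : 0 < ε)
    (hβ : 0 ≤ β₁) (hβ1 : β₁ < 1) (hη : 0 < η) (hη1 : η ≤ 1) (hT : 10 ≤ T)
    (hg : Measurable (Function.uncurry g)) (hz : ∀ t, 1 ≤ t → Measurable (z t))
    (hF : fbar f x₁ = F) (hBV : BoundedVariance μ f (horizonParams v ε β₁ η T) g x₁ z T C)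
    (hn : n ≤ T) :
    ∫ ω, expWeight f L C v ε β₁ η T g x₁ (fun k => z k ω) n ∂μ ≤ initConst d L v β₁ F := by
  induction n with
  | zero => simp [expWeight_zero hF]
  | succ n ih =>
    have h := setIntegral_expWeight_succ_le hf hlip hb hL hC hv hε hβ hβ1 hη hη1 hT hg hz hF hBV
      (Nat.lt_of_succ_le hn) (@MeasurableSet.univ _ (history z n))
    rw [setIntegral_univ, setIntegral_univ] at h
    exact h.trans (ih (by omega))

lemma mul_measureReal_expWeight_le
    (hf : Differentiable ℝ f) (hlip : ∀ x y, ‖gradient f x - gradient f y‖ ≤ L * ‖x - y‖)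
    (hb : BddBelow (Set.range f)) (hL : 0 < L) (hC : 0 ≤ C) (hv : 0 < v) (hε : 0 < ε)
    (hβ : 0 ≤ β₁) (hβ1 : β₁ < 1) (hη : 0 < η) (hη1 : η ≤ 1) (hT : 10 ≤ T)
    (hg : Measurable (Function.uncurry g)) (hz : ∀ t, 1 ≤ t → Measurable (z t))
    (hF : fbar f x₁ = F) (hBV : BoundedVariance μ f (horizonParams v ε β₁ η T) g x₁ z T C)
    (a : ℝ) :
    a * μ.real {ω | ∃ n ≤ T, a ≤ expWeight f L C v ε β₁ η T g x₁ (fun k => z k ω) n}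
      ≤ initConst d L v β₁ F := by
  have h := mul_measureReal_exists_le (μ := μ) (N := T) (history_le hz) (history_mono z)
    (fun n => stronglyMeasurable_expWeight (C := C) (v := v) (ε := ε) (β₁ := β₁) (η := η)
      (T := T) (x₁ := x₁) hf hlip hL hg n)
    (fun n ω => (Real.exp_pos _).le)
    (fun n hn => integrable_expWeight hf hlip hb hL hC hv hε hβ hβ1 hη hη1 hT hg hz hF hn)
    (fun n hn S hS => setIntegral_expWeight_succ_le hf hlip hb hL hC hv hε hβ hβ1 hη hη1 hT hg hz
      hF hBV hn hS) a
  refine h.trans ?_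
  exact integral_expWeight_le hf hlip hb hL hC hv hε hβ hβ1 hη hη1 hT hg hz hF hBV (Nat.zero_le T)

/-- Markov's inequality for the bound on the root of the total second moment. -/
lemma mul_measureReal_massBound_le
    (hf : Differentiable ℝ f) (hlip : ∀ x y, ‖gradient f x - gradient f y‖ ≤ L * ‖x - y‖)
    (hb : BddBelow (Set.range f)) (hL : 0 < L) (hC : 0 ≤ C) (hv : 0 < v) (hε : 0 < ε)
    (hβ : 0 ≤ β₁) (hβ1 : β₁ < 1) (hη : 0 < η) (hη1 : η ≤ 1) (hT : 10 ≤ T)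
    (hg : Measurable (Function.uncurry g)) (hz : ∀ t, 1 ≤ t → Measurable (z t))
    (hF : fbar f x₁ = F) (hBV : BoundedVariance μ f (horizonParams v ε β₁ η T) g x₁ z T C)
    (a : ℝ) :
    a * μ.real {ω | a ≤ √(1 + d * v) + 9 / T * ∑ k ∈ Finset.range T,
          (massWeight d L C v ε β₁ * expWeight f L C v ε β₁ η T g x₁ (fun k => z k ω) k
            + ‖noise f (horizonParams v ε β₁ η T) g x₁ (fun k => z k ω) k‖ ^ 2)}
      ≤ massConst d L C v ε β₁ F := by
  have hT' : (10 : ℝ) ≤ T := by exact_mod_cast hT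
  have hG := continuous_gradient hlip hL
  have hmw := massWeight_nonneg (d := d) (L := L) (C := C) (v := v) (ε := ε) (β₁ := β₁)
  have hi1 : ∀ k ∈ Finset.range T, Integrable (fun ω => massWeight d L C v ε β₁
      * expWeight f L C v ε β₁ η T g x₁ (fun k => z k ω) k) μ := fun k hk =>
    (integrable_expWeight hf hlip hb hL hC hv hε hβ hβ1 hη hη1 hT hg hz hF
      (Finset.mem_range.1 hk).le).const_mul _
  have hi2 : ∀ k ∈ Finset.range T, Integrable (fun ω =>
      ‖noise f (horizonParams v ε β₁ η T) g x₁ (fun k => z k ω) k‖ ^ 2) μ := fun k hk =>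
    (noise_condExp hG hg hz hBV (Finset.mem_range.1 hk)).1.integrable_norm_pow two_ne_zero
  have hi12 : ∀ k ∈ Finset.range T, Integrable (fun ω => massWeight d L C v ε β₁
      * expWeight f L C v ε β₁ η T g x₁ (fun k => z k ω) k
        + ‖noise f (horizonParams v ε β₁ η T) g x₁ (fun k => z k ω) k‖ ^ 2) μ := fun k hk =>
    (hi1 k hk).add (hi2 k hk)
  have hi3 : Integrable (fun ω => ∑ k ∈ Finset.range T,
          (massWeight d L C v ε β₁ * expWeight f L C v ε β₁ η T g x₁ (fun k => z k ω) k
            + ‖noise f (horizonParams v ε β₁ η T) g x₁ (fun k => z k ω) k‖ ^ 2)) μ :=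
    integrable_finsetSum _ hi12
  refine (mul_meas_ge_le_integral_of_nonneg (Filter.Eventually.of_forall fun ω => ?_)
    ((integrable_const _).add (hi3.const_mul _)) a).trans ?_
  · refine add_nonneg (Real.sqrt_nonneg _) (mul_nonneg (by positivity)
      (Finset.sum_nonneg fun k _ => ?_))
    have : 0 < expWeight f L C v ε β₁ η T g x₁ (fun k => z k ω) k := Real.exp_pos _
    positivity
  · rw [integral_add' (integrable_const _) (hi3.const_mul _), integral_const_mul,
      integral_finsetSum _ hi12]
    -- The bound is uniform in k, so the prefactor 9/T averages the T terms to a constant.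
    have hterm : ∀ k ∈ Finset.range T, ∫ ω, (massWeight d L C v ε β₁
        * expWeight f L C v ε β₁ η T g x₁ (fun k => z k ω) k
            + ‖noise f (horizonParams v ε β₁ η T) g x₁ (fun k => z k ω) k‖ ^ 2) ∂μ
        ≤ massWeight d L C v ε β₁ * initConst d L v β₁ F + C := by
      intro k hk
      have hkT := Finset.mem_range.1 hk
      rw [integral_add (hi1 k hk) (hi2 k hk), integral_const_mul]
      gcongr
      · exact integral_expWeight_le hf hlip hb hL hC hv hε hβ hβ1 hη hη1 hT hg hz hF hBV hkT.le
      · rw [← integral_condExp (history_le hz k)]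
        refine (integral_mono_ae integrable_condExp (integrable_const C)
          (noise_condExp hG hg hz hBV hkT).2.2).trans ?_
        simp
    have hsum := Finset.sum_le_card_nsmul _ _ _ hterm
    rw [Finset.card_range, nsmul_eq_mul] at hsum
    unfold massConst
    have h9 := mul_le_mul_of_nonneg_left hsum (by positivity : 0 ≤ 9 / (T : ℝ))
    have e : 9 / (T : ℝ) * (T * (massWeight d L C v ε β₁ * initConst d L v β₁ F + C))
        = 9 * (massWeight d L C v ε β₁ * initConst d L v β₁ F + C) := by
      field_simp
    rw [e] at h9
    simpa using h9

end Expectations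

/-! ### From the accumulated exact decrease to the energy. -/

section EnergyBound

open MeasureTheory
open scoped InnerProductSpace

variable {d : ℕ} {f : EuclideanSpace ℝ (Fin d) → ℝ} {L C v ε β₁ η F : ℝ} {T n : ℕ}
  {Ω Z : Type*} {g : EuclideanSpace ℝ (Fin d) → Z → EuclideanSpace ℝ (Fin d)}
  {x₁ : EuclideanSpace ℝ (Fin d)}

/-- With t = n + 1, the preconditioner is taken after the step and the gradient before it. -/
lemma energy_eq_sum_range (p : Params) (ζ : ℕ → Z) (T : ℕ) :
    energy f p g x₁ ζ T = ∑ n ∈ Finset.range T, ∑ i, p.precond (adam p g x₁ ζ (n + 1)).v i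
      * gradient f (adam p g x₁ ζ n).x i ^ 2 := by
  unfold energy
  rw [show Finset.Icc 1 T = Finset.Ico 1 (T + 1) from rfl, Finset.sum_Ico_eq_sum_range]
  refine Finset.sum_congr rfl fun n _ => ?_
  rw [add_comm 1 n]
  rfl

/-- The realized preconditioner is controlled by the one of the exact gradient. -/
lemma precond_step_le (hη : 0 < η) (hε : 0 < ε) (hT : 10 ≤ T) {s : State d}
    (hvi : ∀ i, 0 < s.v i) (g G : EuclideanSpace ℝ (Fin d)) (i : Fin d) :
    (horizonParams v ε β₁ η T).precond ((horizonParams v ε β₁ η T).step s g).v i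
      ≤ (1 + ‖G‖ / ε)
        * (horizonParams v ε β₁ η T).precond ((horizonParams v ε β₁ η T).step s G).v i := by
  have hT' : (10 : ℝ) ≤ T := by exact_mod_cast hT
  rw [horizonParams_precond, horizonParams_precond, step_v_apply, step_v_apply]
  have ha := mul_pos (discount_pos hT) (hvi i)
  have hle := discount_mul_le_secondMoment T (s.v i) (g i)
  set a := (1 - 1 / (T : ℝ)) * s.v i
  -- The exact root is at most √a + ‖G‖ and the realized one at least √a, whence the ratio 1 +
  -- ‖G‖/ε.
  have h1 : √(a + 1 / (T : ℝ) * G i ^ 2) ≤ √a + ‖G‖ := by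
    apply Real.sqrt_le_iff.2 ⟨by positivity, ?_⟩
    have h2 : G i ^ 2 ≤ ‖G‖ ^ 2 := by
      rw [← sq_abs]
      have := abs_apply_le_norm G i
      gcongr
    have h3 : 1 / (T : ℝ) * G i ^ 2 ≤ 1 * ‖G‖ ^ 2 := by
      gcongr
      rw [div_le_one] <;> linarith
    have h4 := Real.sq_sqrt ha.le
    nlinarith [mul_nonneg (Real.sqrt_nonneg a) (norm_nonneg G)]
  have h5 : √a ≤ √(a + 1 / (T : ℝ) * g i ^ 2) := Real.sqrt_le_sqrt hle
  have h6 : √(a + 1 / (T : ℝ) * G i ^ 2) + ε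
      ≤ (1 + ‖G‖ / ε) * (√(a + 1 / (T : ℝ) * g i ^ 2) + ε) := by
    have e : ‖G‖ / ε * ε = ‖G‖ := by field_simp
    have : 0 ≤ ‖G‖ / ε * √(a + 1 / (T : ℝ) * g i ^ 2) := by positivity
    nlinarith
  have h7 : (√(a + 1 / (T : ℝ) * g i ^ 2) + ε)⁻¹
      ≤ (1 + ‖G‖ / ε) * (√(a + 1 / (T : ℝ) * G i ^ 2) + ε)⁻¹ := by
    rw [← div_eq_mul_inv, inv_eq_one_div, div_le_div_iff₀ (by positivity) (by positivity), one_mul]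
    exact h6
  calc _ ≤ η / √T * ((1 + ‖G‖ / ε) * (√(a + 1 / (T : ℝ) * G i ^ 2) + ε)⁻¹) := by gcongr
    _ = _ := by ring

/-- The energy is at most cubic in a bound for the potential and the accumulated decrease. -/
lemma energy_le
    (hf : Differentiable ℝ f) (hlip : ∀ x y, ‖gradient f x - gradient f y‖ ≤ L * ‖x - y‖)
    (hb : BddBelow (Set.range f)) (hL : 0 < L) (hv : 0 < v) (hε : 0 < ε) (hβ : 0 ≤ β₁)
    (hβ1 : β₁ < 1) (hη : 0 < η) (hη1 : η ≤ 1) (hT : 10 ≤ T)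
    {ζ : ℕ → Z} {Y : ℝ}
    (hY : ∀ n ≤ T, rad f (horizonParams v ε β₁ η T) (adam (horizonParams v ε β₁ η T) g x₁ ζ n)
        + accum f (horizonParams v ε β₁ η T) g x₁ ζ n ≤ Y) :
    energy f (horizonParams v ε β₁ η T) g x₁ ζ T
      ≤ (1 + 2 * slopeConst d L β₁ * Y / ε) * (2 * Y) * Y := by
  have hQ := one_le_slopeConst d hL hβ hβ1
  have hacc := accum_nonneg (v := v) (β₁ := β₁) (T := T) (g := g) (x₁ := x₁) (ζ := ζ) hb hε hη
  have hG := fun n hn => norm_gradient_le_rad hf hlip hb hL hv hε hβ hβ1 hη hη1 hT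
    (admissible_adam (ε := ε) (η := η) hT hv hβ hβ1 g x₁ ζ n) hn
  have hpre := fun n => precond_step_le (v := v) (β₁ := β₁) hη hε hT
    ((admissible_adam (ε := ε) (η := η) hT hv hβ hβ1 g x₁ ζ n).v_pos hT hv)
  have hD0 : ∀ s : State d, 0 ≤ exactDecrease f (horizonParams v ε β₁ η T) s :=
    fun s => exactDecrease_nonneg hb hε hη
  rw [energy_eq_sum_range]
  set p := horizonParams v ε β₁ η T
  have hrad1 : ∀ s, 1 ≤ rad f p s := fun s => one_le_sqrt_fbar hb _
  have hradY : ∀ n ≤ T, rad f p (adam p g x₁ ζ n) ≤ Y := fun n hn => by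
    linarith [hY n hn, hacc n]
  have hY1 : 1 ≤ Y := (hrad1 _).trans (hradY 0 (Nat.zero_le T))
  -- One factor Y comes from ‖∇f‖ in the change of preconditioner, one from undoing the division by
  -- 2r; the third will come from the accumulated decrease.
  have hterm : ∀ n ∈ Finset.range T, ∑ i, p.precond (adam p g x₁ ζ (n + 1)).v i
      * gradient f (adam p g x₁ ζ n).x i ^ 2
      ≤ (1 + 2 * slopeConst d L β₁ * Y / ε) * (2 * Y)
        * exactDecrease f p (adam p g x₁ ζ n) := by
    intro n hn
    have hnT := (Finset.mem_range.1 hn).le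
    have hadam : adam p g x₁ ζ (n + 1)
      = p.step (adam p g x₁ ζ n) (g (adam p g x₁ ζ n).x (ζ (n + 1))) := rfl
    rw [hadam]
    have hp := hpre n (g (adam p g x₁ ζ n).x (ζ (n + 1))) (gradient f (adam p g x₁ ζ n).x)
    have hGn := hG n hnT
    have hr := hradY n hnT
    have hr1 := hrad1 (adam p g x₁ ζ n)
    have hD := hD0 (adam p g x₁ ζ n)
    set s := adam p g x₁ ζ n
    set G := gradient f s.x with hGd
    have hGY : ‖G‖ ≤ 2 * slopeConst d L β₁ * Y := hGn.trans (by gcongr)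
    have hdec : ∑ i, p.precond (p.step s G).v i * G i ^ 2
        = 2 * rad f p s * exactDecrease f p s := by
      unfold exactDecrease decrease
      rw [mul_div_cancel₀ _ (by linarith : 2 * rad f p s ≠ 0)]
      refine Finset.sum_congr rfl fun i _ => ?_
      rw [← hGd]; ring
    calc ∑ i, p.precond (p.step s (g s.x (ζ (n + 1)))).v i * G i ^ 2
        ≤ ∑ i, (1 + ‖G‖ / ε) * (p.precond (p.step s G).v i * G i ^ 2) := by
          refine Finset.sum_le_sum fun i _ => ?_
          rw [← mul_assoc]
          exact mul_le_mul_of_nonneg_right (hp i) (sq_nonneg _)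
      _ = (1 + ‖G‖ / ε) * (2 * rad f p s) * exactDecrease f p s := by
          rw [← Finset.mul_sum, hdec]; ring
      _ ≤ _ := by gcongr
  refine (Finset.sum_le_sum hterm).trans ?_
  rw [← Finset.mul_sum]
  have : ∑ n ∈ Finset.range T, exactDecrease f p (adam p g x₁ ζ n) ≤ Y := by
    have h1 := hY T le_rfl
    have h2 := hrad1 (adam p g x₁ ζ T)
    unfold accum at h1
    linarith
  gcongr

section Final

variable (d : ℕ) (L C v ε β₁ F : ℝ)

/-- The additive constant of the high-probability bound of the potential. -/
def tailConst : ℝ :=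
  compConst d L C v ε β₁ + |Real.log (2 * initConst d L v β₁ F)|
    + |Real.log (2 * massConst d L C v ε β₁ F)|

/-- The logarithm of the universal constant of the energy bound. -/
def logUniversal : ℝ :=
  1 + tailConst d L C v ε β₁ F + 8 / expRate d L β₁ ^ 2
    + 32 * slopeConst d L β₁ / (ε * expRate d L β₁ ^ 3)

end Final

lemma tailConst_nonneg
    (hL : 0 < L) (hC : 0 ≤ C) (hε : 0 < ε) (hβ : 0 ≤ β₁) (hβ1 : β₁ < 1)
    : 0 ≤ tailConst d L C v ε β₁ F := by
  have := compConst_nonneg (d := d) (v := v) hL hC hε hβ hβ1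
  unfold tailConst; positivity

lemma one_le_lconst {β : ℝ} (hL : 0 < L) : 1 ≤ lconst d L β := by
  unfold lconst
  apply Real.one_le_exp
  positivity

/-- The cubic bound is dominated by the sixth power of the logarithm. -/
lemma cubic_le_energyBound
    (hL : 0 < L) (hC : 0 ≤ C) (hε : 0 < ε) (hβ : 0 ≤ β₁) (hβ1 : β₁ < 1)
    {B₀ δ : ℝ} (hδ : 0 < δ) (hδ1 : δ < 1) {Y : ℝ}
    (hYdef : expRate d L β₁ * Y = tailConst d L C v ε β₁ F + 2 * Real.log (1 / δ)) :
    (1 + 2 * slopeConst d L β₁ * Y / ε) * (2 * Y) * Y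
      ≤ energyBound (lconst d L β₁) B₀ (Real.exp (logUniversal d L C v ε β₁ F)) δ := by
  have hl := expRate_pos d hL hβ hβ1
  have hQ := one_le_slopeConst d hL hβ hβ1
  have hK := tailConst_nonneg (d := d) (v := v) (F := F) hL hC hε hβ hβ1
  have hlog : 0 ≤ Real.log (1 / δ) := Real.log_nonneg (by rw [one_le_div hδ]; exact hδ1.le)
  have hlc := one_le_lconst (d := d) (β := β₁) hL
  set l := expRate d L β₁
  set Q := slopeConst d L β₁
  set K := tailConst d L C v ε β₁ F
  have hMdef : logUniversal d L C v ε β₁ F = 1 + K + 8 / l ^ 2 + 32 * Q / (ε * l ^ 3) := rfl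
  set M := logUniversal d L C v ε β₁ F
  have hc1 : 0 ≤ 8 / l ^ 2 := by positivity
  have hc2 : 0 ≤ 32 * Q / (ε * l ^ 3) := by positivity
  -- With U = e^M this is at most log(24 l U²/δ), l here being `lconst`. As M contains the
  -- coefficients of the polynomial, one power of t absorbs them and leaves t⁴ ≤ t⁶.
  set t := 2 * M + Real.log (1 / δ) with ht
  have ht1 : 1 ≤ t := by linarith
  have htM : M ≤ t := by linarith
  have hY : Y = (K + 2 * Real.log (1 / δ)) / l := by
    rw [eq_div_iff hl.ne', mul_comm]; exact hYdef
  have hY0 : 0 ≤ Y := by rw [hY]; positivity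
  have hYt : Y ≤ 2 * t / l := by
    rw [hY]
    gcongr
    linarith
  have hcub : (1 + 2 * Q * Y / ε) * (2 * Y) * Y ≤ t ^ 6 := by
    calc (1 + 2 * Q * Y / ε) * (2 * Y) * Y
        ≤ (1 + 2 * Q * (2 * t / l) / ε) * (2 * (2 * t / l)) * (2 * t / l) := by gcongr
      _ = 8 / l ^ 2 * t ^ 2 + 32 * Q / (ε * l ^ 3) * t ^ 3 := by field_simp; ring
      _ ≤ 8 / l ^ 2 * t ^ 3 + 32 * Q / (ε * l ^ 3) * t ^ 3 := by
          gcongr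
          norm_num
      _ = (8 / l ^ 2 + 32 * Q / (ε * l ^ 3)) * t ^ 3 := by ring
      _ ≤ t * t ^ 3 := by gcongr; linarith
      _ = t ^ 4 := by ring
      _ ≤ t ^ 6 := pow_le_pow_right₀ ht1 (by norm_num)
  have hbig : t ≤ Real.log (24 * lconst d L β₁ * Real.exp M ^ 2 / δ) := by
    rw [Real.le_log_iff_exp_le (by positivity), ht, Real.exp_add, Real.exp_log (by positivity),
      two_mul, Real.exp_add, ← sq, mul_one_div]
    gcongr
    have : 0 < Real.exp M ^ 2 := by positivity
    nlinarith
  have h6 : t ^ 6 ≤ (2 * Real.log (24 * lconst d L β₁ * Real.exp M ^ 2 / δ)) ^ 6 := by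
    gcongr
    linarith
  have h0 : 0 ≤ (2 * Real.log (24 * lconst d L β₁ * Real.exp M ^ 2 / δ)) ^ 6 := by positivity
  refine hcub.trans (h6.trans ?_)
  unfold energyBound
  refine le_trans (by linarith : _ ≤ 16 * (2 * Real.log (24 * lconst d L β₁
    * Real.exp M ^ 2 / δ)) ^ 6) ?_
  gcongr
  exact (le_max_right _ _).trans (le_max_right _ _)

end EnergyBound

end AdamEnergy

end

/-! ### The main theorem: two exceptional events and a union bound. -/

open MeasureTheory ProbabilityTheory AdamEnergy in
theorem mainTheorem2 (d : ℕ) (L C v ε β₁ F : ℝ) (hL : 0 < L) (hC : 0 ≤ C) (hv : 0 < v)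
    (hε : 0 < ε) (hβ₁ : 0 ≤ β₁) (hβ₁' : β₁ < 1) :
    -- `U` depends only on `d, L, C, v, ε, β₁` and the initial value `F = f̄(x₁)`
    ∃ U : ℝ, 1 ≤ U ∧
      ∀ {Ω Z : Type*} [MeasurableSpace Ω] [MeasurableSpace Z] (μ : Measure Ω)
        [IsProbabilityMeasure μ]
        (f : EuclideanSpace ℝ (Fin d) → ℝ) (x₁ : EuclideanSpace ℝ (Fin d))
        (g : EuclideanSpace ℝ (Fin d) → Z → EuclideanSpace ℝ (Fin d)) (z : ℕ → Ω → Z)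
        (T : ℕ) (η δ : ℝ),
        Differentiable ℝ f →
        BddBelow (Set.range f) →
        (∀ x y, ‖gradient f x - gradient f y‖ ≤ L * ‖x - y‖) →
        fbar f x₁ = F →
        Measurable (Function.uncurry g) →
        (∀ t, 1 ≤ t → Measurable (z t)) →
        iIndepFun (fun t : ℕ => z (t + 1)) μ →
        10 ≤ T →
        0 < η →
        max (max (8 * d * ε / v ^ (3 / 2 : ℝ) + 8 * d / Real.sqrt v)
          (Dconst β₁ * β₁ * Real.sqrt (d * L) / (1 - β₁))) 1 ≤ 1 / η →
        BoundedVariance μ f (horizonParams v ε β₁ η T) g x₁ z T C →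
        0 < δ → δ < 1 →
        1 - δ ≤ μ.real {ω | energy f (horizonParams v ε β₁ η T) g x₁ (fun s => z s ω) T ≤
          energyBound (lconst d L β₁) (Bconst L v ε F) U δ} := by
  refine ⟨Real.exp (logUniversal d L C v ε β₁ F), ?_, ?_⟩
  · apply Real.one_le_exp
    have h1 := tailConst_nonneg (d := d) (v := v) (F := F) hL hC hε hβ₁ hβ₁'
    have h2 := expRate_pos d hL hβ₁ hβ₁'
    have h3 := one_le_slopeConst d hL hβ₁ hβ₁'
    unfold logUniversal
    positivity
  intro Ω Z _ _ μ _ f x₁ g z T η δ hf hb hlip hF hg hz _ hT hη hηle hBV hδ hδ1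
  have hη1 : η ≤ 1 := by
    have := (le_max_right _ _).trans hηle
    rwa [one_le_div hη] at this
  have hl := expRate_pos d hL hβ₁ hβ₁'
  have hw0 : 0 < initConst d L v β₁ F := Real.exp_pos _
  have hmw := massWeight_nonneg (d := d) (L := L) (C := C) (v := v) (ε := ε) (β₁ := β₁)
  have hc0 : 0 < massConst d L C v ε β₁ F := by
    unfold massConst
    have : 0 < √(1 + d * v) := Real.sqrt_pos.2 (by positivity)
    positivity
  set w₀ := initConst d L v β₁ F with hw₀
  set c₀ := massConst d L C v ε β₁ F with hc₀
  -- The levels are twice the expectation bounds over δ, so that each exceptional event has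
  -- probability at most δ/2.
  set A := {ω | ∃ n ≤ T, 2 * w₀ / δ ≤ expWeight f L C v ε β₁ η T g x₁ (fun k => z k ω) n}
    with hA
  set B := {ω | 2 * c₀ / δ ≤ √(1 + d * v) + 9 / T * ∑ k ∈ Finset.range T,
          (massWeight d L C v ε β₁ * expWeight f L C v ε β₁ η T g x₁ (fun k => z k ω) k
            + ‖noise f (horizonParams v ε β₁ η T) g x₁ (fun k => z k ω) k‖ ^ 2)} with hB
  have hPA : μ.real A ≤ δ / 2 := by
    have h := mul_measureReal_expWeight_le hf hlip hb hL hC hv hε hβ₁ hβ₁' hη hη1 hT hg hz hF hBV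
      (2 * w₀ / δ)
    rw [← le_div_iff₀' (by positivity)] at h
    refine h.trans (le_of_eq ?_)
    rw [← hw₀]
    field_simp
  have hPB : μ.real B ≤ δ / 2 := by
    have h := mul_measureReal_massBound_le hf hlip hb hL hC hv hε hβ₁ hβ₁' hη hη1 hT hg hz hF hBV
      (2 * c₀ / δ)
    rw [← le_div_iff₀' (by positivity)] at h
    refine h.trans (le_of_eq ?_)
    rw [← hc₀]
    field_simp
  set G := {ω | energy f (horizonParams v ε β₁ η T) g x₁ (fun s => z s ω) T ≤
    energyBound (lconst d L β₁) (Bconst L v ε F) (Real.exp (logUniversal d L C v ε β₁ F)) δ}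
  -- Subadditivity over a cover of the whole space avoids any measurability of these events.
  have hcover : (Set.univ : Set Ω) ⊆ G ∪ (A ∪ B) := by
    intro ω _
    by_cases hω : ω ∈ A ∪ B
    · exact Or.inr hω
    refine Or.inl ?_
    rw [Set.mem_union, not_or] at hω
    obtain ⟨hωA, hωB⟩ := hω
    simp only [hA, Set.mem_ofPred_eq, not_exists, not_and, not_le] at hωA
    simp only [hB, Set.mem_ofPred_eq, not_le] at hωB
    -- Each of the levels 2w₀/δ and 2c₀/δ contributes one log(1/δ).
    set Y := (tailConst d L C v ε β₁ F + 2 * Real.log (1 / δ)) / expRate d L β₁ with hYd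
    have hYdef : expRate d L β₁ * Y = tailConst d L C v ε β₁ F + 2 * Real.log (1 / δ) := by
      rw [hYd]; field_simp
    refine le_trans (energy_le hf hlip hb hL hv hε hβ₁ hβ₁' hη hη1 hT (Y := Y) fun n hn => ?_)
      (cubic_le_energyBound hL hC hε hβ₁ hβ₁' hδ hδ1 hYdef)
    refine le_of_mul_le_mul_left (a := expRate d L β₁) ?_ hl
    rw [hYdef]
    refine (rate_mul_le_log_expWeight (C := C) hL hC hv hε hβ₁ hβ₁' hT hn).trans ?_
    have hm := sqrt_mass_le (g := g) (x₁ := x₁) (ζ := fun k => z k ω)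
      hf hlip hb hL hC hv hε hβ₁ hβ₁' hη hη1 hT hn
    have hm1 := one_le_mass hv hT
      (admissible_adam (ε := ε) (η := η) hT hv hβ₁ hβ₁' g x₁ (fun k => z k ω) n)
    have h1 : Real.log (expWeight f L C v ε β₁ η T g x₁ (fun k => z k ω) n)
        ≤ Real.log (2 * w₀ / δ) := Real.log_le_log (Real.exp_pos _) (hωA n hn).le
    have h2 := Real.log_le_log (Real.sqrt_pos.2 (by linarith)) (hm.trans hωB.le)
    rw [div_eq_mul_one_div (2 * w₀), Real.log_mul (by positivity) (by positivity)] at h1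
    rw [div_eq_mul_one_div (2 * c₀), Real.log_mul (by positivity) (by positivity)] at h2
    have h3 := le_abs_self (Real.log (2 * w₀))
    have h4 := le_abs_self (Real.log (2 * c₀))
    have h5 : tailConst d L C v ε β₁ F = compConst d L C v ε β₁ + |Real.log (2 * w₀)|
      + |Real.log (2 * c₀)| := rfl
    rw [h5]
    linarith
  have h1 : (1 : ℝ) ≤ μ.real (G ∪ (A ∪ B)) := by
    rw [← probReal_univ (μ := μ)]
    exact measureReal_mono hcover
  have h2 := measureReal_union_le (μ := μ) G (A ∪ B)
  have h3 := measureReal_union_le (μ := μ) A B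
  linarith
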